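/- $\mathsf{RCA}_0^\omega$ is the classical many-sorted theory $\mathsf{E}\text{-}\mathsf{PRA}^\omega+\mathsf{QF}\text{-}\mathsf{AC}^{1,0}$ in the language of all finite types, with constants $0$, $S$, the combinators $\Pi$, $\Sigma$ in all types and the recursor $R_0$ of type $0$. Only equality of type $0$ is primitive. The axioms are the successor axioms, the defining equations of the constants, extensionality in all types, quantifier-free induction, and $(\forall f^1)(\exists n^0)A_0(f,n)\to(\exists F^2)(\forall f^1)A_0(f,F(f))$ for quantifier-free $A_0$. Sets of numbers are given by $\{0,1\}$-valued characteristic functions. Consider the following formulas. - $\mathsf{URT}^2_2(\Psi)$: for every 2-colouring $c:[\mathbb N]^2\to\{0,1\}$, $\Psi(c)$ is an infinite set that is homogeneous for $c$. - $\mathsf{UWKL}(\Phi)$: for every infinite binary tree $T\subseteq 2^{<\mathbb N}$, $\Phi(T)$ is an infinite path through $T$. - $(\exists^2)$: $(\exists\varphi^2)(\forall g^1)[(\exists x^0)\,g(x)=0\leftrightarrow\varphi(g)=0]$. Let $\mathsf{URT}^2_2$ be $(\exists\Psi)\,\mathsf{URT}^2_2(\Psi)$ and $\mathsf{UWKL}$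 be $(\exists\Phi)\,\mathsf{UWKL}(\Phi)$. **Corollary.** $\mathsf{RCA}_0^\omega$ proves $\mathsf{URT}^2_2\leftrightarrow\mathsf{UWKL}$, $\mathsf{URT}^2_2\leftrightarrow(\exists^2)$ and $\mathsf{UWKL}\leftrightarrow(\exists^2)$. Moreover, the equivalence $\mathsf{URT}^2_2\leftrightarrow\mathsf{UWKL}$ is explicit: there are closed terms $s,t$ of the language such that $\mathsf{RCA}_0^\omega$ proves 1. $(\forall\Phi)\big[\mathsf{UWKL}(\Phi)\to\mathsf{URT}^2_2(s(\Phi))\big]$, and 2. $(\forall\Psi,\Xi)\big[\big(\mathsf{URT}^2_2(\Psi)\wedge\Xi\text{ witnesses that the sets }\Psi(c)\text{ are infinite}\big)\to\mathsf{UWKL}(t(\Psi,\Xi))\big]$, where "$\Xi$ witnesses that the sets $\Psi(c)$ are infinite" means that $\Xi(c,k)>k$ and $\Xi(c,k)\in\Psi(c)$ for every 2-colouring $c$ of $[\mathbb N]^2$ and every $k\in\mathbb N$. (For every $\Psi$ with $\mathsf{URT}^2_2(\Psi)$, such a $\Xi$ exists by an unbounded search, that is, by $\mathsf{QF}\text{-}\mathsf{AC}^{1,0}$.)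 -/

import Mathlib

namespace HORM

/-! ## The language of arithmetic in all finite types -/

/-- Finite types: `nat` is the type `0`, and `σ ⇒ τ` is the type of functionals from `σ` to `τ`. -/
inductive Ty : Type
  | nat : Ty
  | arr : Ty → Ty → Ty

infixr:60 " ⇒ " => Ty.arr

/-- The type `1 = 0 → 0` of number-theoretic functions (and of sets of numbers). -/
abbrev Ty.one : Ty := Ty.nat ⇒ Ty.nat

/-- The type `0 → 0 → 0` of colourings of pairs. -/
abbrev Ty.col : Ty := Ty.nat ⇒ Ty.nat ⇒ Ty.nat

/-- The constants: zero, successor, the combinators `Π` and `Σ` in all types, and the recursor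
`R₀` for primitive recursion of type `0`. -/
inductive Con : Ty → Type
  | zero : Con Ty.nat
  | succ : Con (Ty.nat ⇒ Ty.nat)
  | K (σ τ : Ty) : Con (σ ⇒ τ ⇒ σ)
  | S (ρ σ τ : Ty) : Con ((ρ ⇒ σ ⇒ τ) ⇒ (ρ ⇒ σ) ⇒ ρ ⇒ τ)
  | R : Con (Ty.nat ⇒ Ty.nat ⇒ (Ty.nat ⇒ Ty.nat ⇒ Ty.nat) ⇒ Ty.nat)

/-- Typed de Bruijn variables: positions in the list of types of the free variables. -/
inductive Var : List Ty → Ty → Type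
  | z {Γ : List Ty} {σ : Ty} : Var (σ :: Γ) σ
  | s {Γ : List Ty} {σ τ : Ty} : Var Γ σ → Var (τ :: Γ) σ

/-- Terms with free variables in `Γ`. -/
inductive Tm (Γ : List Ty) : Ty → Type
  | var {σ : Ty} : Var Γ σ → Tm Γ σ
  | con {σ : Ty} : Con σ → Tm Γ σ
  | app {σ τ : Ty} : Tm Γ (σ ⇒ τ) → Tm Γ σ → Tm Γ τ

infixl:70 " ⬝ " => Tm.app

/-- Formulas with free variables in `Γ`. The only prime formulas are equations of type `0`.
The logic is classical, so `⊥`, `→`, `∀` suffice as primitives. -/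
inductive Fm : List Ty → Type
  | eq {Γ : List Ty} : Tm Γ Ty.nat → Tm Γ Ty.nat → Fm Γ
  | bot {Γ : List Ty} : Fm Γ
  | imp {Γ : List Ty} : Fm Γ → Fm Γ → Fm Γ
  | all {Γ : List Ty} (σ : Ty) : Fm (σ :: Γ) → Fm Γ

namespace Fm

variable {Γ : List Ty}

def neg (A : Fm Γ) : Fm Γ := A.imp bot
def and (A B : Fm Γ) : Fm Γ := (A.imp B.neg).neg
def or (A B : Fm Γ) : Fm Γ := A.neg.imp B
def iff (A B : Fm Γ) : Fm Γ := (A.imp B).and (B.imp A)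
def ex (σ : Ty) (A : Fm (σ :: Γ)) : Fm Γ := (all σ A.neg).neg

/-- Quantifier-free formulas. -/
def QF {Γ : List Ty} : Fm Γ → Prop
  | eq _ _ => True
  | bot => True
  | imp A B => QF A ∧ QF B
  | all _ _ => False

end Fm

/-! ### Renaming and substitution -/

abbrev Ren (Γ Δ : List Ty) : Type := ∀ σ : Ty, Var Γ σ → Var Δ σ

def Ren.lift {Γ Δ : List Ty} (r : Ren Γ Δ) (τ : Ty) : Ren (τ :: Γ) (τ :: Δ)
  | _, Var.z => Var.z
  | _, Var.s v => Var.s (r _ v)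

def Tm.rename {Γ Δ : List Ty} (r : Ren Γ Δ) : {σ : Ty} → Tm Γ σ → Tm Δ σ
  | _, Tm.var v => Tm.var (r _ v)
  | _, Tm.con c => Tm.con c
  | _, Tm.app s t => Tm.app (Tm.rename r s) (Tm.rename r t)

/-- Weakening by one new variable. -/
def Tm.wk {Γ : List Ty} {σ τ : Ty} (t : Tm Γ σ) : Tm (τ :: Γ) σ :=
  t.rename (fun _ v => Var.s v)

/-- A closed term, seen as a term with (unused) free variables in `Γ`. -/
def Tm.ofClosed {Γ : List Ty} {σ : Ty} (t : Tm [] σ) : Tm Γ σ :=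
  t.rename (fun _ v => by cases v)

abbrev Sub (Γ Δ : List Ty) : Type := ∀ σ : Ty, Var Γ σ → Tm Δ σ

def Sub.lift {Γ Δ : List Ty} (θ : Sub Γ Δ) (τ : Ty) : Sub (τ :: Γ) (τ :: Δ)
  | _, Var.z => Tm.var Var.z
  | _, Var.s v => (θ _ v).wk

/-- Substitute `t` for the variable `0`. -/
def Sub.single {Γ : List Ty} {τ : Ty} (t : Tm Γ τ) : Sub (τ :: Γ) Γ
  | _, Var.z => t
  | _, Var.s v => Tm.var v

def Tm.subst {Γ Δ : List Ty} (θ : Sub Γ Δ) : {σ : Ty} → Tm Γ σ → Tm Δ σ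
  | _, Tm.var v => θ _ v
  | _, Tm.con c => Tm.con c
  | _, Tm.app s t => Tm.app (Tm.subst θ s) (Tm.subst θ t)

def Fm.subst : {Γ Δ : List Ty} → Sub Γ Δ → Fm Γ → Fm Δ
  | _, _, θ, Fm.eq s t => Fm.eq (s.subst θ) (t.subst θ)
  | _, _, _, Fm.bot => Fm.bot
  | _, _, θ, Fm.imp A B => Fm.imp (A.subst θ) (B.subst θ)
  | _, _, θ, Fm.all σ A => Fm.all σ (A.subst (θ.lift σ))

def Fm.rename : {Γ Δ : List Ty} → Ren Γ Δ → Fm Γ → Fm Δ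
  | _, _, r, Fm.eq s t => Fm.eq (s.rename r) (t.rename r)
  | _, _, _, Fm.bot => Fm.bot
  | _, _, r, Fm.imp A B => Fm.imp (A.rename r) (B.rename r)
  | _, _, r, Fm.all σ A => Fm.all σ (A.rename (r.lift σ))

def Fm.wk {Γ : List Ty} {τ : Ty} (A : Fm Γ) : Fm (τ :: Γ) :=
  A.rename (fun _ v => Var.s v)

/-- `A.inst t` is `A` with `t` for the variable `0`. -/
def Fm.inst {Γ : List Ty} {τ : Ty} (A : Fm (τ :: Γ)) (t : Tm Γ τ) : Fm Γ :=
  A.subst (Sub.single t)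

section Abbreviations

variable {Γ : List Ty} {ρ σ τ υ : Ty}

abbrev v0 : Tm (σ :: Γ) σ := Tm.var Var.z
abbrev v1 : Tm (ρ :: σ :: Γ) σ := Tm.var (Var.s Var.z)
abbrev v2 : Tm (ρ :: τ :: σ :: Γ) σ := Tm.var (Var.s (Var.s Var.z))

def zero : Tm Γ Ty.nat := Tm.con Con.zero
def succ (t : Tm Γ Ty.nat) : Tm Γ Ty.nat := Tm.con Con.succ ⬝ t
def one : Tm Γ Ty.nat := succ zero

/-- `recur n x f` is the term `R₀ n x f`. -/
def recur (n x : Tm Γ Ty.nat) (f : Tm Γ (Ty.nat ⇒ Ty.nat ⇒ Ty.nat)) : Tm Γ Ty.nat :=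
  Tm.con Con.R ⬝ n ⬝ x ⬝ f

/-- Equality in type `σ`: `s x₁ … x_k = t x₁ … x_k` for all `x₁, …, x_k`. -/
def eqAt : {Γ : List Ty} → (σ : Ty) → Tm Γ σ → Tm Γ σ → Fm Γ
  | _, Ty.nat, s, t => Fm.eq s t
  | _, Ty.arr σ τ, s, t => Fm.all σ (eqAt τ (s.wk ⬝ v0) (t.wk ⬝ v0))

/-- The term `λ x. t`, defined from the combinators. -/
def lam : {ρ : Ty} → Tm (σ :: Γ) ρ → Tm Γ (σ ⇒ ρ)
  | _, Tm.var Var.z => Tm.con (Con.S σ (σ ⇒ σ) σ) ⬝ Tm.con (Con.K σ (σ ⇒ σ)) ⬝ Tm.con (Con.K σ σ)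
  | ρ, Tm.var (Var.s v) => Tm.con (Con.K ρ σ) ⬝ Tm.var v
  | ρ, Tm.con c => Tm.con (Con.K ρ σ) ⬝ Tm.con c
  | ρ, @Tm.app _ υ _ s t => Tm.con (Con.S σ υ ρ) ⬝ lam s ⬝ lam t

end Abbreviations

/-! ## The base theory -/

/-- Substitution `n ↦ F f`, taking a formula in the variables `n, f, …` to one in `f, F, …`. -/
def choiceSub (Γ : List Ty) :
    Sub (Ty.nat :: Ty.one :: Γ) (Ty.one :: (Ty.one ⇒ Ty.nat) :: Γ)
  | _, Var.z => v1 ⬝ v0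
  | _, Var.s Var.z => v0
  | _, Var.s (Var.s v) => Tm.var (Var.s (Var.s v))

/-- Substitution `x ↦ S x`. -/
def succSub (Γ : List Ty) : Sub (Ty.nat :: Γ) (Ty.nat :: Γ)
  | _, Var.z => succ v0
  | _, Var.s v => Tm.var (Var.s v)

/-- The non-logical axioms of `RCA₀^ω`, that is, of `E-PRA^ω` (successor, defining equations of
`Π`, `Σ` and `R₀`, extensionality in all types, quantifier-free induction) together with
`QF-AC^{1,0}`; free variables are parameters. -/
inductive Ax : {Γ : List Ty} → Fm Γ → Prop
  | succ_ne_zero {Γ : List Ty} (t : Tm Γ Ty.nat) : Ax (Fm.eq (succ t) zero).neg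
  | succ_inj {Γ : List Ty} (s t : Tm Γ Ty.nat) :
      Ax ((Fm.eq (succ s) (succ t)).imp (Fm.eq s t))
  | K {Γ : List Ty} {σ τ : Ty} (x : Tm Γ σ) (y : Tm Γ τ) :
      Ax (eqAt σ (Tm.con (Con.K σ τ) ⬝ x ⬝ y) x)
  | S {Γ : List Ty} {ρ σ τ : Ty} (x : Tm Γ (ρ ⇒ σ ⇒ τ)) (y : Tm Γ (ρ ⇒ σ)) (z : Tm Γ ρ) :
      Ax (eqAt τ (Tm.con (Con.S ρ σ τ) ⬝ x ⬝ y ⬝ z) (x ⬝ z ⬝ (y ⬝ z)))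
  | R_zero {Γ : List Ty} (x : Tm Γ Ty.nat) (f : Tm Γ (Ty.nat ⇒ Ty.nat ⇒ Ty.nat)) :
      Ax (Fm.eq (recur zero x f) x)
  | R_succ {Γ : List Ty} (n x : Tm Γ Ty.nat) (f : Tm Γ (Ty.nat ⇒ Ty.nat ⇒ Ty.nat)) :
      Ax (Fm.eq (recur (succ n) x f) (f ⬝ recur n x f ⬝ n))
  | ext {Γ : List Ty} {σ τ : Ty} (f : Tm Γ (σ ⇒ τ)) (x y : Tm Γ σ) :
      Ax ((eqAt σ x y).imp (eqAt τ (f ⬝ x) (f ⬝ y)))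
  | qfInd {Γ : List Ty} (A : Fm (Ty.nat :: Γ)) : A.QF →
      Ax ((A.inst zero).imp
        ((Fm.all Ty.nat (A.imp (A.subst (succSub Γ)))).imp (Fm.all Ty.nat A)))
  | qfAC {Γ : List Ty} (A : Fm (Ty.nat :: Ty.one :: Γ)) : A.QF →
      Ax ((Fm.all Ty.one (Fm.ex Ty.nat A)).imp
        (Fm.ex (Ty.one ⇒ Ty.nat) (Fm.all Ty.one (A.subst (choiceSub Γ)))))

/-- `Prov H A`: the formula `A` is derivable from the hypotheses `H` and the axioms of `RCA₀^ω`,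
in natural deduction for classical many-sorted predicate logic with equality of type `0`. -/
inductive Prov : {Γ : List Ty} → List (Fm Γ) → Fm Γ → Prop
  | ax {Γ : List Ty} {H : List (Fm Γ)} {A : Fm Γ} : Ax A → Prov H A
  | hyp {Γ : List Ty} {H : List (Fm Γ)} {A : Fm Γ} : A ∈ H → Prov H A
  | impI {Γ : List Ty} {H : List (Fm Γ)} {A B : Fm Γ} : Prov (A :: H) B → Prov H (A.imp B)
  | impE {Γ : List Ty} {H : List (Fm Γ)} {A B : Fm Γ} : Prov H (A.imp B) → Prov H A → Prov H B
  | raa {Γ : List Ty} {H : List (Fm Γ)} {A : Fm Γ} : Prov (A.neg :: H) Fm.bot → Prov H A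
  | allI {Γ : List Ty} {H : List (Fm Γ)} {σ : Ty} {A : Fm (σ :: Γ)} :
      Prov (H.map Fm.wk) A → Prov H (Fm.all σ A)
  | allE {Γ : List Ty} {H : List (Fm Γ)} {σ : Ty} {A : Fm (σ :: Γ)} (t : Tm Γ σ) :
      Prov H (Fm.all σ A) → Prov H (A.inst t)
  | eqRefl {Γ : List Ty} {H : List (Fm Γ)} (t : Tm Γ Ty.nat) : Prov H (Fm.eq t t)
  | eqSubst {Γ : List Ty} {H : List (Fm Γ)} (A : Fm (Ty.nat :: Γ)) (s t : Tm Γ Ty.nat) :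
      Prov H (Fm.eq s t) → Prov H (A.inst s) → Prov H (A.inst t)

/-- `RCA₀^ω` proves the sentence `A`. -/
def Provable (A : Fm []) : Prop := Prov [] A

/-! ## The principles -/

section Principles

variable {Γ : List Ty}

def add (s t : Tm Γ Ty.nat) : Tm Γ Ty.nat := recur t s (lam (lam (succ v1)))

def pred (t : Tm Γ Ty.nat) : Tm Γ Ty.nat := recur t zero (lam (lam v0))

/-- Truncated subtraction. -/
def monus (s t : Tm Γ Ty.nat) : Tm Γ Ty.nat := recur t s (lam (lam (pred v1)))

def le (s t : Tm Γ Ty.nat) : Fm Γ := Fm.eq (monus s t) zero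

def lt (s t : Tm Γ Ty.nat) : Fm Γ := le (succ s) t

/-- `X` is the characteristic function of a set of numbers. -/
def isSet (X : Tm Γ Ty.one) : Fm Γ := Fm.all Ty.nat (le (X.wk ⬝ v0) one)

/-- `n ∈ X`, for a set given by its characteristic function. -/
def mem (n : Tm Γ Ty.nat) (X : Tm Γ Ty.one) : Fm Γ := Fm.eq (X ⬝ n) one

/-- `X` is infinite: `∀ k ∃ n > k, n ∈ X`. -/
def infinite (X : Tm Γ Ty.one) : Fm Γ :=
  Fm.all Ty.nat (Fm.ex Ty.nat ((lt v1 v0).and (mem v0 X.wk.wk)))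

/-- `c` is a colouring of the two-element sets of numbers with the colours `0` and `1`; the set
`{x, y}` with `x < y` has the colour `c x y`. -/
def colouring (c : Tm Γ Ty.col) : Fm Γ :=
  Fm.all Ty.nat (Fm.all Ty.nat ((lt v1 v0).imp (le (c.wk.wk ⬝ v1 ⬝ v0) one)))

/-- All two-element subsets of `X` have the colour `i` under `c`. -/
def homogeneousOf (c : Tm Γ Ty.col) (X : Tm Γ Ty.one) (i : Tm Γ Ty.nat) : Fm Γ :=
  Fm.all Ty.nat (Fm.all Ty.nat ((lt v1 v0).imp ((mem v1 X.wk.wk).imp ((mem v0 X.wk.wk).imp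
    (Fm.eq (c.wk.wk ⬝ v1 ⬝ v0) i.wk.wk)))))

def homogeneous (c : Tm Γ Ty.col) (X : Tm Γ Ty.one) : Fm Γ :=
  (homogeneousOf c X zero).or (homogeneousOf c X one)

/-- `Ψ` sends every 2-colouring of pairs to an infinite homogeneous set. -/
def URTfor (Ψ : Tm Γ (Ty.col ⇒ Ty.one)) : Fm Γ :=
  Fm.all Ty.col ((colouring v0).imp
    ((isSet (Ψ.wk ⬝ v0)).and ((infinite (Ψ.wk ⬝ v0)).and (homogeneous v0 (Ψ.wk ⬝ v0)))))

/-- Uniform Ramsey's theorem for pairs and two colours. -/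
def URT : Fm [] := Fm.ex (Ty.col ⇒ Ty.one) (URTfor v0)

/-- `Ξ` witnesses that the sets `Ψ c` are infinite: `k < Ξ c k ∈ Ψ c` for all 2-colourings `c`
and all `k`. -/
def infinitudeWitness (Ψ : Tm Γ (Ty.col ⇒ Ty.one)) (Ξ : Tm Γ (Ty.col ⇒ Ty.nat ⇒ Ty.nat)) :
    Fm Γ :=
  Fm.all Ty.col ((colouring v0).imp (Fm.all Ty.nat
    ((lt v0 (Ξ.wk.wk ⬝ v1 ⬝ v0)).and (mem (Ξ.wk.wk ⬝ v1 ⬝ v0) (Ψ.wk.wk ⬝ v1)))))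

/-- Every number is the code of exactly one finite binary string: `0` codes the empty string, and
if `s` codes a string and `b ≤ 1`, then `2 s + b + 1` codes its extension by the bit `b`. -/
def snoc (s b : Tm Γ Ty.nat) : Tm Γ Ty.nat := succ (add (add s s) b)

/-- The code of the string `f 0, …, f (k - 1)`, for a function `f` with values in `{0, 1}`. -/
def initSeg (f : Tm Γ Ty.one) (k : Tm Γ Ty.nat) : Tm Γ Ty.nat :=
  recur k zero (lam (lam (snoc v1 (f.wk.wk ⬝ v0))))

/-- `T` is a binary tree: a set of (codes of) binary strings, closed under initial segments. -/
def tree (T : Tm Γ Ty.one) : Fm Γ :=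
  (isSet T).and (Fm.all Ty.nat (Fm.all Ty.nat
    ((le v0 one).imp ((mem (snoc v1 v0) T.wk.wk).imp (mem v1 T.wk.wk)))))

/-- `f` is an infinite path through `T`. -/
def path (f T : Tm Γ Ty.one) : Fm Γ :=
  (isSet f).and (Fm.all Ty.nat (mem (initSeg f.wk v0) T.wk))

/-- `Φ` sends every infinite binary tree to an infinite path through it. -/
def UWKLfor (Φ : Tm Γ (Ty.one ⇒ Ty.one)) : Fm Γ :=
  Fm.all Ty.one (((tree v0).and (infinite v0)).imp (path (Φ.wk ⬝ v0) v0))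

/-- Uniform weak König's lemma. -/
def UWKL : Fm [] := Fm.ex (Ty.one ⇒ Ty.one) (UWKLfor v0)

/-- The principle `(∃²)`: some `φ` satisfies `∃ x, g x = 0 ↔ φ g = 0` for all `g` of type `1`. -/
def E2 : Fm [] :=
  Fm.ex (Ty.one ⇒ Ty.nat) (Fm.all Ty.one
    ((Fm.ex Ty.nat (Fm.eq (v1 ⬝ v0) zero)).iff (Fm.eq (v1 ⬝ v0) zero)))

end Principles

end HORM

namespace HORM

/-! ## Syntax: renaming and substitution -/

/-! Derivations are never written out. A Henkin completeness theorem (`provable_of_models`) reduces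
provability to truth in every extensional model of the axioms without choice, and the mathematics is
then done inside an arbitrary, possibly nonstandard, model. Choice is not needed: the functionals
are all given by explicit terms. In a model only quantifier-free induction is available, so each
predicate used in an induction must be the zero set of an element of the model (`Rep`, `Dec`).

Both principles pass through (∃²). In one direction the idea is Grilliot's: a functional with a
discontinuity decides existence, by extensionality. For `UWKL`, let b be the first bit chosen in the
full tree, and cut off the strings extending ⟨b⟩ whose code is not below the first zero of g.
Without a zero the tree is the same object, so the bit is again b; with a zero no path starts with b
(`isE2_e2OfUWKL`). For `URT`, let a < b lie in the set chosen for the constant colouring 0, and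
recolour {x, y} by 1 once y > b and g has a zero below y. Without a zero nothing changes; with one,
an infinite homogeneous set must have colour 1 and cannot contain both a and b (`isE2_e2OfURT`).

Conversely, (∃²) decides arithmetical questions. It decides which strings have infinitely many
extensions, and so yields the leftmost path of an infinite tree (`isPath_leftPathT`). For a
colouring c, the columns c 0 y, c 1 y, … generate an infinite tree, and a path e through it predicts
colours: each initial segment of e is realised by arbitrarily late columns, hence there is an
infinite set on which c x y = e x for x < y (`IsBound.infinite`, `IsBound.apply_eq`). One more use
of (∃²) picks a value of e occurring infinitely often there (`homT_spec`). Composing these terms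
gives the explicit equivalence. -/

theorem Tm.rename_eq_subst {Γ Δ : List Ty} (r : Ren Γ Δ) {σ : Ty} (t : Tm Γ σ) :
    t.rename r = t.subst (fun _ v => Tm.var (r _ v)) := by
  induction t with
  | var v => rfl
  | con c => rfl
  | app s t hs ht => simp only [Tm.rename, Tm.subst, hs, ht]

theorem Tm.subst_var {Γ : List Ty} {σ : Ty} (t : Tm Γ σ) :
    t.subst (fun _ v => Tm.var v) = t := by
  induction t with
  | var v => rfl
  | con c => rfl
  | app s t hs ht => simp only [Tm.subst, hs, ht]

theorem Tm.subst_subst {Γ Δ Θ : List Ty} (θ : Sub Γ Δ) (η : Sub Δ Θ) {σ : Ty} (t : Tm Γ σ) :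
    (t.subst θ).subst η = t.subst (fun _ v => (θ _ v).subst η) := by
  induction t with
  | var v => rfl
  | con c => rfl
  | app s t hs ht => simp only [Tm.subst, hs, ht]

theorem Tm.wk_subst {Γ Δ : List Ty} {τ σ : Ty} (η : Sub (τ :: Γ) Δ) (t : Tm Γ σ) :
    t.wk.subst η = t.subst (fun _ v => η _ (Var.s v)) := by
  rw [Tm.wk, Tm.rename_eq_subst, Tm.subst_subst]; rfl

theorem Tm.subst_wk {Γ Δ : List Ty} {τ σ : Ty} (θ : Sub Γ Δ) (t : Tm Γ σ) :
    (t.subst θ).wk (τ := τ) = t.wk.subst (θ.lift τ) := by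
  rw [Tm.wk_subst, Tm.wk, Tm.rename_eq_subst, Tm.subst_subst]
  congr 1; funext σ v
  rw [← Tm.rename_eq_subst]; rfl

theorem Sub.lift_var {Γ : List Ty} (τ : Ty) :
    Sub.lift (fun _ v => Tm.var v : Sub Γ Γ) τ = fun _ v => Tm.var v := by
  funext σ v; cases v <;> rfl

theorem Ren.lift_var {Γ Δ : List Ty} (r : Ren Γ Δ) (τ : Ty) :
    (fun σ v => Tm.var (r.lift τ σ v)) = Sub.lift (fun _ v => Tm.var (r _ v)) τ := by
  funext σ v; cases v <;> rfl

theorem Sub.lift_comp {Γ Δ Θ : List Ty} (θ : Sub Γ Δ) (η : Sub Δ Θ) (τ : Ty) :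
    (fun σ v => (θ.lift τ σ v).subst (η.lift τ)) =
      Sub.lift (fun _ v => (θ _ v).subst η) τ := by
  funext σ v
  cases v with
  | z => rfl
  | s v => exact (Tm.subst_wk _ _).symm

theorem Fm.rename_eq_subst {Γ Δ : List Ty} (r : Ren Γ Δ) (A : Fm Γ) :
    A.rename r = A.subst (fun _ v => Tm.var (r _ v)) := by
  induction A generalizing Δ with
  | eq s t => simp only [Fm.rename, Fm.subst, Tm.rename_eq_subst]
  | bot => rfl
  | imp A B hA hB => simp only [Fm.rename, Fm.subst, hA, hB]
  | all σ A hA => simp only [Fm.rename, Fm.subst, hA, Ren.lift_var]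

theorem Fm.subst_var {Γ : List Ty} (A : Fm Γ) : A.subst (fun _ v => Tm.var v) = A := by
  induction A with
  | eq s t => simp only [Fm.subst, Tm.subst_var]
  | bot => rfl
  | imp A B hA hB => simp only [Fm.subst, hA, hB]
  | all σ A hA => simp only [Fm.subst, Sub.lift_var, hA]

theorem Fm.subst_subst {Γ Δ Θ : List Ty} (θ : Sub Γ Δ) (η : Sub Δ Θ) (A : Fm Γ) :
    (A.subst θ).subst η = A.subst (fun _ v => (θ _ v).subst η) := by
  induction A generalizing Δ Θ with
  | eq s t => simp only [Fm.subst, Tm.subst_subst]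
  | bot => rfl
  | imp A B hA hB => simp only [Fm.subst, hA, hB]
  | all σ A hA => simp only [Fm.subst, hA, Sub.lift_comp]

theorem Fm.wk_eq_subst {Γ : List Ty} {τ : Ty} (A : Fm Γ) :
    A.wk (τ := τ) = A.subst (fun _ v => Tm.var (Var.s v)) :=
  Fm.rename_eq_subst _ _

theorem Fm.subst_wk {Γ Δ : List Ty} {τ : Ty} (θ : Sub Γ Δ) (A : Fm Γ) :
    (A.subst θ).wk (τ := τ) = A.wk.subst (θ.lift τ) := by
  rw [Fm.wk_eq_subst, Fm.wk_eq_subst, Fm.subst_subst, Fm.subst_subst]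
  congr 1; funext σ v
  rw [← Tm.rename_eq_subst]; rfl

/-- Extend a substitution by a term for the variable `0`. -/
def Sub.cons {Γ Δ : List Ty} {τ : Ty} (t : Tm Δ τ) (θ : Sub Γ Δ) : Sub (τ :: Γ) Δ
  | _, Var.z => t
  | _, Var.s v => θ _ v

theorem Tm.subst_single_wk {Γ : List Ty} {σ τ : Ty} (t : Tm Γ σ) (u : Tm Γ τ) :
    t.wk.subst (Sub.single u) = t := by
  rw [Tm.wk_subst]; exact Tm.subst_var t

theorem Fm.lift_inst {Γ Δ : List Ty} {τ : Ty} (θ : Sub Γ Δ) (A : Fm (τ :: Γ)) (t : Tm Δ τ) :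
    (A.subst (θ.lift τ)).inst t = A.subst (Sub.cons t θ) := by
  rw [Fm.inst, Fm.subst_subst]
  congr 1; funext σ v
  cases v with
  | z => rfl
  | s v => exact Tm.subst_single_wk _ _

theorem Fm.inst_subst {Γ Δ : List Ty} {τ : Ty} (θ : Sub Γ Δ) (A : Fm (τ :: Γ)) (t : Tm Γ τ) :
    (A.inst t).subst θ = (A.subst (θ.lift τ)).inst (t.subst θ) := by
  rw [Fm.lift_inst, Fm.inst, Fm.subst_subst]
  congr 1; funext σ v
  cases v <;> rfl

theorem eqAt_subst {Γ Δ : List Ty} (θ : Sub Γ Δ) (σ : Ty) (s t : Tm Γ σ) :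
    (eqAt σ s t).subst θ = eqAt σ (s.subst θ) (t.subst θ) := by
  induction σ generalizing Γ Δ with
  | nat => rfl
  | arr σ τ _ ih => simp only [eqAt, Fm.subst, ih, Tm.subst, Tm.subst_wk]; rfl

theorem Fm.QF.subst {Γ Δ : List Ty} {A : Fm Γ} (hA : A.QF) (θ : Sub Γ Δ) : (A.subst θ).QF := by
  induction A generalizing Δ with
  | eq s t => trivial
  | bot => trivial
  | imp A B ihA ihB => exact ⟨ihA hA.1 θ, ihB hA.2 θ⟩
  | all σ A _ => exact hA.elim

/-- The axioms are schemes with parameters. Only induction and choice contain substitutions of their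
own, which have to be commuted past θ. -/
theorem Ax.subst {Γ Δ : List Ty} {A : Fm Γ} (h : Ax A) (θ : Sub Γ Δ) : Ax (A.subst θ) := by
  cases h with
  | succ_ne_zero t => exact Ax.succ_ne_zero (t.subst θ)
  | succ_inj s t => exact Ax.succ_inj (s.subst θ) (t.subst θ)
  | K x y => rw [eqAt_subst]; exact Ax.K (x.subst θ) (y.subst θ)
  | S x y z => rw [eqAt_subst]; exact Ax.S (x.subst θ) (y.subst θ) (z.subst θ)
  | R_zero x f => exact Ax.R_zero (x.subst θ) (f.subst θ)
  | R_succ n x f => exact Ax.R_succ (n.subst θ) (x.subst θ) (f.subst θ)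
  | ext f x y =>
    simp only [Fm.subst, eqAt_subst]
    exact Ax.ext (f.subst θ) (x.subst θ) (y.subst θ)
  | qfInd A hA =>
    have h := Ax.qfInd (A.subst (θ.lift _)) (hA.subst _)
    have e : (A.subst (θ.lift Ty.nat)).subst (succSub Δ) =
        (A.subst (succSub Γ)).subst (θ.lift Ty.nat) := by
      rw [Fm.subst_subst, Fm.subst_subst]
      congr 1; funext σ v
      cases v with
      | z => rfl
      | s v =>
        change (θ σ v).wk.subst (succSub Δ) = (θ σ v).wk
        rw [Tm.wk_subst, Tm.wk, Tm.rename_eq_subst]; rfl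
    rw [e] at h
    simp only [Fm.subst, Fm.inst_subst]
    exact h
  | qfAC A hA =>
    have h := Ax.qfAC (A.subst ((θ.lift _).lift _)) (hA.subst _)
    have e : (A.subst ((θ.lift Ty.one).lift Ty.nat)).subst (choiceSub Δ) =
        (A.subst (choiceSub Γ)).subst ((θ.lift _).lift _) := by
      rw [Fm.subst_subst, Fm.subst_subst]
      congr 1; funext σ v
      rcases v with _ | _ | v
      · rfl
      · rfl
      · change (θ _ v).wk.wk.subst (choiceSub Δ) = (θ _ v).wk.wk
        rw [Tm.wk_subst, Tm.wk_subst, Tm.wk, Tm.wk, Tm.rename_eq_subst,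
          Tm.rename_eq_subst, Tm.subst_subst]
        rfl
    rw [e] at h
    exact h


/-! ## Derivations -/

theorem Prov.mono {Γ : List Ty} {H : List (Fm Γ)} {A : Fm Γ} (h : Prov H A) :
    ∀ {H' : List (Fm Γ)}, H ⊆ H' → Prov H' A := by
  induction h with
  | ax h => exact fun _ => .ax h
  | hyp h => exact fun hs => .hyp (hs h)
  | impI _ ih => exact fun hs => .impI (ih (List.cons_subset_cons _ hs))
  | impE _ _ ih₁ ih₂ => exact fun hs => .impE (ih₁ hs) (ih₂ hs)
  | raa _ ih => exact fun hs => .raa (ih (List.cons_subset_cons _ hs))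
  | allI _ ih => exact fun hs => .allI (ih (List.map_subset _ hs))
  | allE t _ ih => exact fun hs => .allE t (ih hs)
  | eqRefl t => exact fun _ => .eqRefl t
  | eqSubst A s t _ _ ih₁ ih₂ => exact fun hs => .eqSubst A s t (ih₁ hs) (ih₂ hs)

theorem Prov.subst {Γ : List Ty} {H : List (Fm Γ)} {A : Fm Γ} (h : Prov H A) :
    ∀ {Δ : List Ty} (θ : Sub Γ Δ), Prov (H.map (Fm.subst θ)) (A.subst θ) := by
  induction h with
  | ax h => exact fun θ => .ax (h.subst θ)
  | hyp h => exact fun θ => .hyp (List.mem_map_of_mem h)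
  | impI _ ih => exact fun θ => .impI (ih θ)
  | impE _ _ ih₁ ih₂ => exact fun θ => .impE (ih₁ θ) (ih₂ θ)
  | raa _ ih => exact fun θ => .raa (ih θ)
  | @allI Γ H σ A _ ih =>
    intro Δ θ
    refine .allI ?_
    have h := ih (θ.lift σ)
    have e : (H.map Fm.wk).map (Fm.subst (θ.lift σ)) = (H.map (Fm.subst θ)).map Fm.wk := by
      rw [List.map_map, List.map_map]
      exact List.map_congr_left fun B _ => (Fm.subst_wk θ B).symm
    rwa [e] at h
  | allE t _ ih =>
    intro Δ θ
    rw [Fm.inst_subst]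
    exact .allE _ (ih θ)
  | eqRefl t => exact fun θ => .eqRefl _
  | eqSubst A s t _ _ ih₁ ih₂ =>
    intro Δ θ
    rw [Fm.inst_subst]
    refine .eqSubst _ (s.subst θ) _ (ih₁ θ) ?_
    rw [← Fm.inst_subst]
    exact ih₂ θ

theorem Prov.wk {Γ : List Ty} {τ : Ty} {H : List (Fm Γ)} {A : Fm Γ} (h : Prov H A) :
    Prov (H.map (Fm.wk (τ := τ))) A.wk := by
  have h := h.subst (fun _ v => Tm.var (Var.s (τ := τ) v))
  have e : (Fm.subst (fun _ v => Tm.var (Var.s (τ := τ) v)) : Fm Γ → _) = Fm.wk :=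
    funext fun B => (Fm.wk_eq_subst B).symm
  rwa [e] at h

theorem Prov.cut {Γ : List Ty} {H : List (Fm Γ)} {A B : Fm Γ} (h : Prov H A)
    (h' : Prov (A :: H) B) : Prov H B :=
  .impE (.impI h') h

theorem Prov.exfalso {Γ : List Ty} {H : List (Fm Γ)} (A : Fm Γ) (h : Prov H Fm.bot) :
    Prov H A :=
  .raa (h.mono (List.subset_cons_self _ _))

/-- From `∀ x, A` in context `H` one gets `A` for a fresh `x`. -/
theorem Prov.allD {Γ : List Ty} {σ : Ty} {H : List (Fm Γ)} {A : Fm (σ :: Γ)}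
    (h : Prov H (Fm.all σ A)) : Prov (H.map Fm.wk) A := by
  have h' := Prov.allE v0 (h.wk (τ := σ))
  have e : (A.rename (Ren.lift (fun _ v => Var.s v) σ)).inst (v0 (σ := σ) (Γ := Γ)) = A := by
    rw [Fm.rename_eq_subst, Ren.lift_var, Fm.lift_inst]
    conv_rhs => rw [← Fm.subst_var A]
    congr 1; funext σ v
    cases v <;> rfl
  rwa [e] at h'

theorem Prov.eqSymm {Γ : List Ty} {H : List (Fm Γ)} {s t : Tm Γ Ty.nat}
    (h : Prov H (Fm.eq s t)) : Prov H (Fm.eq t s) := by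
  have h' := Prov.eqSubst (Fm.eq v0 s.wk) s t h
  simp only [Fm.inst, Fm.subst, Tm.subst_single_wk] at h'
  exact h' (.eqRefl s)

theorem Prov.eqTrans {Γ : List Ty} {H : List (Fm Γ)} {s t u : Tm Γ Ty.nat}
    (h : Prov H (Fm.eq s t)) (h₁ : Prov H (Fm.eq t u)) : Prov H (Fm.eq s u) := by
  have h' := Prov.eqSubst (Fm.eq s.wk v0) t u h₁
  simp only [Fm.inst, Fm.subst, Tm.subst_single_wk] at h'
  exact h' h

theorem Prov.eqAt_refl {σ : Ty} : ∀ {Γ : List Ty} {H : List (Fm Γ)} (s : Tm Γ σ),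
    Prov H (eqAt σ s s) := by
  induction σ with
  | nat => exact fun s => .eqRefl s
  | arr σ τ _ ih => exact fun s => .allI (ih _)

theorem Prov.eqAt_symm {σ : Ty} : ∀ {Γ : List Ty} {H : List (Fm Γ)} {s t : Tm Γ σ},
    Prov H (eqAt σ s t) → Prov H (eqAt σ t s) := by
  induction σ with
  | nat => exact fun h => h.eqSymm
  | arr σ τ _ ih => exact fun h => .allI (ih h.allD)

theorem Prov.eqAt_trans {σ : Ty} : ∀ {Γ : List Ty} {H : List (Fm Γ)} {s t u : Tm Γ σ},
    Prov H (eqAt σ s t) → Prov H (eqAt σ t u) → Prov H (eqAt σ s u) := by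
  induction σ with
  | nat => exact fun h h' => h.eqTrans h'
  | arr σ τ _ ih => exact fun h h' => .allI (ih h.allD h'.allD)

theorem Prov.eqAt_inst {Γ : List Ty} {H : List (Fm Γ)} {σ τ : Ty} {f g : Tm Γ (σ ⇒ τ)}
    (h : Prov H (eqAt (σ ⇒ τ) f g)) (x : Tm Γ σ) : Prov H (eqAt τ (f ⬝ x) (g ⬝ x)) := by
  have h' := Prov.allE x h
  rw [Fm.inst, eqAt_subst] at h'
  simpa only [Tm.subst, Tm.subst_single_wk, Sub.single] using h'

/-- The extensionality axiom handles the argument. This congruence makes application well defined on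
the term model. -/
theorem Prov.eqAt_app {Γ : List Ty} {H : List (Fm Γ)} {σ τ : Ty} {f g : Tm Γ (σ ⇒ τ)}
    {x y : Tm Γ σ} (h : Prov H (eqAt (σ ⇒ τ) f g)) (h' : Prov H (eqAt σ x y)) :
    Prov H (eqAt τ (f ⬝ x) (g ⬝ y)) :=
  (h.eqAt_inst x).eqAt_trans (.impE (.ax (.ext g x y)) h')

/-- Some closed term of each type. -/
def closedTm {Γ : List Ty} : (σ : Ty) → Tm Γ σ
  | Ty.nat => zero
  | Ty.arr σ τ => Tm.con (Con.K τ σ) ⬝ closedTm τ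

/-- `H` is consistent. -/
def Consistent {Γ : List Ty} (H : List (Fm Γ)) : Prop := ¬ Prov H Fm.bot

theorem Consistent.decide {Γ : List Ty} {H : List (Fm Γ)} (h : Consistent H) (A : Fm Γ) :
    Consistent (A :: H) ∨ Consistent (A.neg :: H) := by
  by_contra! hc
  rw [Consistent, Consistent, not_not, not_not] at hc
  exact h (Prov.cut (.impI hc.1) hc.2)

/-- Adding a Henkin formula for the fresh variable `0` preserves consistency. -/
theorem Consistent.henkin {Γ : List Ty} {σ : Ty} {H : List (Fm Γ)} (h : Consistent H) (B : Fm (σ :: Γ)) :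
    Consistent (B.imp (Fm.all σ B).wk :: H.map Fm.wk) := by
  intro hp
  have hn := Prov.impI hp
  have hB : Prov (H.map Fm.wk) B := by
    -- A refuted implication has a true premise, so B holds of the fresh variable; generalising, the
    -- conclusion holds too, a contradiction.
    refine .raa (.impE (hn.mono (List.subset_cons_self _ _)) (.impI (.exfalso _ ?_)))
    exact .impE (.hyp (List.mem_cons_of_mem _ List.mem_cons_self)) (.hyp List.mem_cons_self)
  have hA := (Prov.allI hB).wk (τ := σ)
  have hb : Prov (H.map (Fm.wk (τ := σ))) Fm.bot :=
    .impE hn (.impI (hA.mono (List.subset_cons_self _ _)))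
  -- The fresh variable is removed again by instantiating it, which needs every type to be inhabited
  -- by a term.
  exact h (Prov.allE (closedTm σ) (Prov.allI hb))


/-! ## The language is countable -/

def Ty.code : Ty → ℕ
  | Ty.nat => 0
  | Ty.arr σ τ => Nat.pair σ.code τ.code + 1

theorem Ty.code_injective : Function.Injective Ty.code := by
  intro σ
  induction σ with
  | nat => intro τ h; cases τ <;> simp_all [Ty.code]
  | arr σ τ ih₁ ih₂ =>
    intro υ h
    cases υ with
    | nat => simp [Ty.code] at h
    | arr σ' τ' =>
      simp only [Ty.code, Nat.add_right_cancel_iff, Nat.pair_eq_pair] at h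
      rw [ih₁ h.1, ih₂ h.2]

def Con.code : {σ : Ty} → Con σ → ℕ
  | _, Con.zero => Nat.pair 0 0
  | _, Con.succ => Nat.pair 1 0
  | _, Con.K σ τ => Nat.pair 2 (Nat.pair σ.code τ.code)
  | _, Con.S ρ σ τ => Nat.pair 3 (Nat.pair ρ.code (Nat.pair σ.code τ.code))
  | _, Con.R => Nat.pair 4 0

/-- The types are not known to agree in advance, hence the equality in the sigma type; likewise for
variables and terms. -/
theorem Con.code_injective {σ τ : Ty} (c : Con σ) (d : Con τ) (h : c.code = d.code) :
    (⟨σ, c⟩ : Σ σ, Con σ) = ⟨τ, d⟩ := by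
  cases c <;> cases d <;> simp only [Con.code, Nat.pair_eq_pair] at h <;>
    first
    | rfl
    | omega
    | (obtain ⟨-, h₁, h₂⟩ := h
       cases Ty.code_injective h₁; cases Ty.code_injective h₂; rfl)
    | (obtain ⟨-, h₁, h₂, h₃⟩ := h
       cases Ty.code_injective h₁; cases Ty.code_injective h₂; cases Ty.code_injective h₃; rfl)

def Var.code : {Γ : List Ty} → {σ : Ty} → Var Γ σ → ℕ
  | _, _, Var.z => 0
  | _, _, Var.s v => v.code + 1

theorem Var.code_injective {Γ : List Ty} {σ τ : Ty} (v : Var Γ σ) (w : Var Γ τ)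
    (h : v.code = w.code) : (⟨σ, v⟩ : Σ σ, Var Γ σ) = ⟨τ, w⟩ := by
  induction v with
  | z => cases w with
    | z => rfl
    | s w => simp [Var.code] at h
  | s v ih => cases w with
    | z => simp [Var.code] at h
    | s w =>
      simp only [Var.code, Nat.add_right_cancel_iff] at h
      cases ih w h
      rfl

def Tm.code {Γ : List Ty} : {σ : Ty} → Tm Γ σ → ℕ
  | _, Tm.var v => Nat.pair 0 v.code
  | _, Tm.con c => Nat.pair 1 c.code
  | _, Tm.app s t => Nat.pair 2 (Nat.pair s.code t.code)

theorem Tm.code_injective {Γ : List Ty} {σ τ : Ty} (s : Tm Γ σ) (t : Tm Γ τ)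
    (h : s.code = t.code) : (⟨σ, s⟩ : Σ σ, Tm Γ σ) = ⟨τ, t⟩ := by
  induction s generalizing τ with
  | var v => cases t <;> simp only [Tm.code, Nat.pair_eq_pair] at h <;> try omega
             cases Var.code_injective _ _ h.2; rfl
  | con c => cases t <;> simp only [Tm.code, Nat.pair_eq_pair] at h <;> try omega
             cases Con.code_injective _ _ h.2; rfl
  | app s₁ s₂ ih₁ ih₂ =>
    cases t <;> simp only [Tm.code, Nat.pair_eq_pair] at h <;> try omega
    cases ih₁ _ h.2.1; cases ih₂ _ h.2.2; rfl

def Fm.code : {Γ : List Ty} → Fm Γ → ℕ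
  | _, Fm.eq s t => Nat.pair 0 (Nat.pair s.code t.code)
  | _, Fm.bot => Nat.pair 1 0
  | _, Fm.imp A B => Nat.pair 2 (Nat.pair A.code B.code)
  | _, Fm.all σ A => Nat.pair 3 (Nat.pair σ.code A.code)

theorem Fm.code_injective {Γ : List Ty} : Function.Injective (Fm.code : Fm Γ → ℕ) := by
  intro A
  induction A with
  | eq s t =>
    intro B h
    cases B <;> simp only [Fm.code, Nat.pair_eq_pair] at h <;> try omega
    cases Tm.code_injective _ _ h.2.1; cases Tm.code_injective _ _ h.2.2; rfl
  | bot =>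
    intro B h
    cases B <;> simp only [Fm.code, Nat.pair_eq_pair] at h <;> first | rfl | omega
  | imp A₁ A₂ ih₁ ih₂ =>
    intro B h
    cases B <;> simp only [Fm.code, Nat.pair_eq_pair] at h <;> try omega
    rw [ih₁ h.2.1, ih₂ h.2.2]
  | all σ A ih =>
    intro B h
    cases B <;> simp only [Fm.code, Nat.pair_eq_pair] at h <;> try omega
    cases Ty.code_injective h.2.1; rw [ih h.2.2]

instance {Γ : List Ty} : Countable (Fm Γ) := Fm.code_injective.countable
instance : Countable Ty := Ty.code_injective.countable

theorem exists_enumTy : ∃ e : ℕ → Ty, Function.Surjective e :=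
  haveI : Nonempty Ty := ⟨Ty.nat⟩
  exists_surjective_nat Ty

theorem exists_enumFm (Γ : List Ty) : ∃ e : ℕ → Fm Γ, Function.Surjective e :=
  haveI : Nonempty (Fm Γ) := ⟨Fm.bot⟩
  exists_surjective_nat (Fm Γ)


/-! ## A Henkin theory over a growing sequence of contexts -/

noncomputable def enumTy : ℕ → Ty := exists_enumTy.choose

theorem enumTy_surjective : Function.Surjective enumTy := exists_enumTy.choose_spec

noncomputable def enumFm (Γ : List Ty) : ℕ → Fm Γ := (exists_enumFm Γ).choose

theorem enumFm_surjective (Γ : List Ty) : Function.Surjective (enumFm Γ) :=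
  (exists_enumFm Γ).choose_spec

/-- The type of the variable that is new in the context number `n + 1`. -/
noncomputable def newTy (n : ℕ) : Ty := enumTy n.unpair.1

noncomputable def ctx : ℕ → List Ty
  | 0 => []
  | n + 1 => newTy n :: ctx n

noncomputable def upRen {n m : ℕ} (h : n ≤ m) : Ren (ctx n) (ctx m) :=
  Nat.leRec (motive := fun m _ => Ren (ctx n) (ctx m)) (fun _ v => v)
    (fun _ _ r _ v => Var.s (r _ v)) h

theorem upRen_refl (n : ℕ) : upRen (le_refl n) = fun _ v => v :=
  Nat.leRec_self _ _

theorem upRen_succ {n m : ℕ} (h : n ≤ m) :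
    upRen (Nat.le_succ_of_le h) = fun _ v => Var.s (τ := newTy m) (upRen h _ v) :=
  Nat.leRec_succ _ _ h

/-- The inclusion of an earlier context into a later one, as a substitution. -/
noncomputable def up {n m : ℕ} (h : n ≤ m) : Sub (ctx n) (ctx m) :=
  fun _ v => Tm.var (upRen h _ v)

theorem up_refl (n : ℕ) : up (le_refl n) = fun _ v => Tm.var v := by
  funext σ v
  change Tm.var (upRen (le_refl n) σ v) = _
  rw [upRen_refl]

theorem up_succ {n m : ℕ} (h : n ≤ m) :
    up (Nat.le_succ_of_le h) = fun _ v => (up h _ v).wk (τ := newTy m) := by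
  funext σ v
  change Tm.var (upRen (Nat.le_succ_of_le h) σ v) = _
  rw [upRen_succ h]
  rfl

theorem up_up {n m k : ℕ} (h : n ≤ m) (h' : m ≤ k) {σ : Ty} (v : Var (ctx n) σ) :
    (up h σ v).subst (up h') = up (h.trans h') σ v := by
  induction k, h' using Nat.le_induction with
  | base => rw [up_refl, Tm.subst_var]
  | succ k h' ih =>
    rw [up_succ h', up_succ (h.trans h')]
    change _ = (up (h.trans h') σ v).wk
    rw [← ih, Tm.wk, Tm.rename_eq_subst, Tm.subst_subst]
    simp only [Tm.wk, Tm.rename_eq_subst]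
    rfl

theorem Tm.up_up {n m k : ℕ} (h : n ≤ m) (h' : m ≤ k) {σ : Ty} (t : Tm (ctx n) σ) :
    (t.subst (up h)).subst (up h') = t.subst (up (h.trans h')) := by
  rw [Tm.subst_subst]; simp only [HORM.up_up]

theorem Fm.up_up {n m k : ℕ} (h : n ≤ m) (h' : m ≤ k) (A : Fm (ctx n)) :
    (A.subst (up h)).subst (up h') = A.subst (up (h.trans h')) := by
  rw [Fm.subst_subst]; simp only [HORM.up_up]

theorem Fm.up_refl {n : ℕ} (A : Fm (ctx n)) : A.subst (up (le_refl n)) = A := by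
  rw [HORM.up_refl, Fm.subst_var]

theorem Tm.up_refl {n : ℕ} {σ : Ty} (t : Tm (ctx n) σ) : t.subst (up (le_refl n)) = t := by
  rw [HORM.up_refl, Tm.subst_var]

theorem up_one (n : ℕ) : up (Nat.le_succ n) = fun _ v => Tm.var (Var.s v) := by
  rw [up_succ (le_refl n), up_refl]; rfl

theorem Fm.up_one {n : ℕ} (A : Fm (ctx n)) :
    A.subst (up (Nat.le_succ n)) = A.wk (τ := newTy n) := by
  rw [HORM.up_one, Fm.wk_eq_subst]
  rfl

-- The formula may come from any earlier context i and is weakened to stage n. The value ⊥ for i > n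
-- is a harmless default: that stage is wasted.
open Classical in
noncomputable def schedAt (σ : Ty) (i j n : ℕ) : Fm (σ :: ctx n) :=
  if h : i ≤ n then (enumFm (σ :: ctx i) j).subst ((up h).lift σ) else Fm.bot

/-- The formula treated at stage `n`. -/
noncomputable def sched (n : ℕ) : Fm (newTy n :: ctx n) :=
  schedAt (newTy n) n.unpair.2.unpair.1 n.unpair.2.unpair.2 n

/-- Stage n codes the type, the context and the index of B; a component of a pair never exceeds the
pair, so context i is already present at stage n. -/
theorem sched_surjective (i : ℕ) (σ : Ty) (B : Fm (σ :: ctx i)) :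
    ∃ n, ∃ h : i ≤ n,
      (⟨newTy n, sched n⟩ : Σ σ, Fm (σ :: ctx n)) = ⟨σ, B.subst ((up h).lift σ)⟩ := by
  obtain ⟨k, rfl⟩ := enumTy_surjective σ
  obtain ⟨j, rfl⟩ := enumFm_surjective _ B
  -- The decoded components are generalised first, because the types of the formulas depend on them.
  have key : ∀ n k' i' j' : ℕ, k' = k → i' = i → j' = j → ∀ h : i ≤ n,
      (⟨enumTy k', schedAt (enumTy k') i' j' n⟩ : Σ σ, Fm (σ :: ctx n)) =
        ⟨enumTy k, (enumFm (enumTy k :: ctx i) j).subst ((up h).lift _)⟩ := by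
    rintro n _ _ _ rfl rfl rfl h
    rw [schedAt, dif_pos h]
  refine ⟨Nat.pair k (Nat.pair i j), (Nat.left_le_pair i j).trans (Nat.right_le_pair k _),
    key _ _ _ _ ?_ ?_ ?_ _⟩ <;> simp

-- One stage does two things: it makes the new variable a witness for the scheduled formula, and it
-- decides that formula.
open Classical in
theorem exists_step (n : ℕ) (H : {H : List (Fm (ctx n)) // Consistent H}) :
    ∃ H' : {H : List (Fm (ctx (n + 1))) // Consistent H}, H.1.map Fm.wk ⊆ H'.1 ∧
      (sched n).imp (Fm.all _ (sched n)).wk ∈ H'.1 ∧ (sched n ∈ H'.1 ∨ (sched n).neg ∈ H'.1) := by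
  have h := H.2.henkin (sched n)
  rcases h.decide (sched n) with h | h
  · exact ⟨⟨_, h⟩, fun _ hx => .tail _ (.tail _ hx), .tail _ (.head _), .inl (.head _)⟩
  · exact ⟨⟨_, h⟩, fun _ hx => .tail _ (.tail _ hx), .tail _ (.head _), .inr (.head _)⟩

noncomputable def chain (H₀ : {H : List (Fm []) // Consistent H}) :
    (n : ℕ) → {H : List (Fm (ctx n)) // Consistent H}
  | 0 => H₀
  | n + 1 => (exists_step n (chain H₀ n)).choose

theorem chain_spec (H₀ : {H : List (Fm []) // Consistent H}) (n : ℕ) :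
    (chain H₀ n).1.map Fm.wk ⊆ (chain H₀ (n + 1)).1 ∧
      (sched n).imp (Fm.all _ (sched n)).wk ∈ (chain H₀ (n + 1)).1 ∧
      (sched n ∈ (chain H₀ (n + 1)).1 ∨ (sched n).neg ∈ (chain H₀ (n + 1)).1) :=
  (exists_step n (chain H₀ n)).choose_spec

theorem chain_up {H₀ : {H : List (Fm []) // Consistent H}} {n m : ℕ} (h : n ≤ m) {A : Fm (ctx n)}
    (hA : Prov (chain H₀ n).1 A) : Prov (chain H₀ m).1 (A.subst (up h)) := by
  induction m, h using Nat.le_induction with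
  | base => rwa [Fm.up_refl]
  | succ m h ih =>
    have h' := (ih.wk (τ := newTy m)).mono (chain_spec H₀ m).1
    rw [← Fm.up_one, Fm.up_up] at h'
    exact h'

/-- A complete consistent theory with witnesses, in the language with the variables of all the
contexts `ctx n`. -/
structure HenkinTheory where
  T : ∀ {n : ℕ}, Fm (ctx n) → Prop
  ofProv : ∀ {n : ℕ} {A : Fm (ctx n)}, Prov [] A → T A
  mp : ∀ {n : ℕ} {A B : Fm (ctx n)}, T (A.imp B) → T A → T B
  not_bot : ∀ {n : ℕ}, ¬ T (Fm.bot : Fm (ctx n))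
  complete : ∀ {n : ℕ} (A : Fm (ctx n)), T A ∨ T A.neg
  up_iff : ∀ {n m : ℕ} (h : n ≤ m) (A : Fm (ctx n)), T (A.subst (up h)) ↔ T A
  henkin : ∀ {n : ℕ} {σ : Ty} (B : Fm (σ :: ctx n)),
    (∀ (m : ℕ) (h : n ≤ m) (t : Tm (ctx m) σ), T (B.subst (Sub.cons t (up h)))) →
      T (Fm.all σ B)

/-- What is derivable at some stage. -/
def Lim (H₀ : {H : List (Fm []) // Consistent H}) {n : ℕ} (A : Fm (ctx n)) : Prop :=
  ∃ m, ∃ h : n ≤ m, Prov (chain H₀ m).1 (A.subst (up h))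

theorem Lim.ofChain {H₀ : {H : List (Fm []) // Consistent H}} {n : ℕ} {A : Fm (ctx n)}
    (h : Prov (chain H₀ n).1 A) : Lim H₀ A :=
  ⟨n, le_refl n, by rwa [Fm.up_refl]⟩

theorem Lim.up_iff {H₀ : {H : List (Fm []) // Consistent H}} {n m : ℕ} (h : n ≤ m) (A : Fm (ctx n)) :
    Lim H₀ (A.subst (up h)) ↔ Lim H₀ A := by
  constructor
  · rintro ⟨k, hk, hp⟩
    rw [Fm.up_up] at hp
    exact ⟨k, _, hp⟩
  · rintro ⟨k, hk, hp⟩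
    have hp' := chain_up (le_max_left k m) hp
    refine ⟨max k m, le_max_right k m, ?_⟩
    rw [Fm.up_up] at hp' ⊢
    exact hp'

theorem Lim.mp {H₀ : {H : List (Fm []) // Consistent H}} {n : ℕ} {A B : Fm (ctx n)}
    (h : Lim H₀ (A.imp B)) (h' : Lim H₀ A) : Lim H₀ B := by
  obtain ⟨k, hk, hp⟩ := h
  obtain ⟨l, hl, hq⟩ := h'
  have hp' := chain_up (le_max_left k l) hp
  have hq' := chain_up (le_max_right k l) hq
  rw [Fm.up_up] at hp' hq'
  exact ⟨max k l, _, .impE hp' hq'⟩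

/-- The schedule only treats formulas with an extra variable, so A is scheduled with a dummy
variable of type 0. -/
theorem Lim.complete (H₀ : {H : List (Fm []) // Consistent H}) {n : ℕ} (A : Fm (ctx n)) :
    Lim H₀ A ∨ Lim H₀ A.neg := by
  obtain ⟨m, h, e⟩ := sched_surjective n Ty.nat A.wk
  have key : ∀ p : Σ σ, Fm (σ :: ctx m), p = ⟨newTy m, sched m⟩ →
      ∀ C : Fm (ctx m), p.2 = C.wk → Lim H₀ C ∨ Lim H₀ C.neg := by
    rintro _ rfl C hC
    rw [← Lim.up_iff (Nat.le_succ m) C, ← Lim.up_iff (Nat.le_succ m) C.neg, Fm.up_one, Fm.up_one]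
    simp only at hC
    have hc := (chain_spec H₀ m).2.2
    rw [hC] at hc
    exact hc.imp (fun h => .ofChain (.hyp h)) (fun h => .ofChain (.hyp h))
  have := key _ e.symm (A.subst (up h)) (Fm.subst_wk _ _).symm
  rw [Lim.up_iff] at this
  exact this.imp_right fun h' => (Lim.up_iff h A.neg).1 h'

theorem Fm.subst_lift_cons {Γ Δ Θ : List Ty} {σ : Ty} (B : Fm (σ :: Γ)) (θ : Sub Γ Δ)
    (η : Sub Δ Θ) (t : Tm Θ σ) :
    (B.subst (θ.lift σ)).subst (Sub.cons t η) =
      B.subst (Sub.cons t (fun _ v => (θ _ v).subst η)) := by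
  rw [Fm.subst_subst]
  congr 1; funext τ v
  cases v with
  | z => rfl
  | s v => exact Tm.wk_subst _ _

/-- At the stage where B is scheduled the theory contains B → ∀B for the new variable, and the
hypothesis applied to that variable supplies B. -/
theorem Lim.henkin {H₀ : {H : List (Fm []) // Consistent H}} {n : ℕ} {σ : Ty} (B : Fm (σ :: ctx n))
    (hB : ∀ (m : ℕ) (h : n ≤ m) (t : Tm (ctx m) σ), Lim H₀ (B.subst (Sub.cons t (up h)))) :
    Lim H₀ (Fm.all σ B) := by
  obtain ⟨m, h, e⟩ := sched_surjective n σ B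
  have key : ∀ p : Σ σ, Fm (σ :: ctx m), p = ⟨newTy m, sched m⟩ →
      (∀ t : Tm (ctx (m + 1)) p.1, Lim H₀ (p.2.subst (Sub.cons t (up (Nat.le_succ m))))) →
      Lim H₀ (Fm.all p.1 p.2) := by
    rintro _ rfl hp
    rw [← Lim.up_iff (Nat.le_succ m), Fm.up_one]
    refine Lim.mp (.ofChain (.hyp (chain_spec H₀ m).2.1)) ?_
    have e' : (sched m).subst (Sub.cons v0 (up (Nat.le_succ m))) = sched m := by
      refine Eq.trans (congrArg (fun θ => Fm.subst θ (sched m)) ?_) (Fm.subst_var (sched m))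
      rw [up_one]; funext τ v; cases v <;> rfl
    exact Eq.mp (congrArg (Lim H₀ (n := m + 1)) e') (hp v0)
  rw [← Lim.up_iff h]
  refine key _ e.symm fun t => ?_
  have := hB (m + 1) (Nat.le_succ_of_le h) t
  simp only [Fm.subst_lift_cons, up_up]
  exact this

/-- A consistent set of sentences extends to a Henkin theory. -/
theorem exists_henkinTheory {H : List (Fm [])} (h : Consistent H) :
    ∃ 𝒯 : HenkinTheory, ∀ A ∈ H, 𝒯.T (n := 0) A :=
  ⟨{ T := Lim ⟨H, h⟩
     ofProv := fun h => .ofChain (h.mono (List.nil_subset _))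
     mp := Lim.mp
     not_bot := fun ⟨m, _, hp⟩ => (chain ⟨H, h⟩ m).2 hp
     complete := Lim.complete _
     up_iff := Lim.up_iff
     henkin := Lim.henkin }, fun _ hA => Lim.ofChain (n := 0) (.hyp hA)⟩


/-! ## Models -/

/-- A structure for the language of finite types. -/
structure Str where
  D : Ty → Type
  con : ∀ {σ : Ty}, Con σ → D σ
  app : ∀ {σ τ : Ty}, D (σ ⇒ τ) → D σ → D τ

/-- Assignments of elements to the variables in `Γ`. -/
abbrev Env (M : Str) (Γ : List Ty) : Type := ∀ σ : Ty, Var Γ σ → M.D σ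

def Env.nil (M : Str) : Env M [] := fun _ v => nomatch v

def Env.cons {M : Str} {Γ : List Ty} {τ : Ty} (d : M.D τ) (ρ : Env M Γ) : Env M (τ :: Γ)
  | _, Var.z => d
  | _, Var.s v => ρ _ v

def Tm.eval {M : Str} {Γ : List Ty} (ρ : Env M Γ) : {σ : Ty} → Tm Γ σ → M.D σ
  | _, Tm.var v => ρ _ v
  | _, Tm.con c => M.con c
  | _, Tm.app s t => M.app (s.eval ρ) (t.eval ρ)

def Fm.Sat {M : Str} : {Γ : List Ty} → Env M Γ → Fm Γ → Prop
  | _, ρ, Fm.eq s t => s.eval ρ = t.eval ρ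
  | _, _, Fm.bot => False
  | _, ρ, Fm.imp A B => A.Sat ρ → B.Sat ρ
  | _, ρ, Fm.all σ A => ∀ d : M.D σ, A.Sat (Env.cons d ρ)

/-- Extensional models of the base theory without choice. -/
class Str.IsModel (M : Str) : Prop where
  ext : ∀ {σ τ : Ty} {f g : M.D (σ ⇒ τ)}, (∀ x, M.app f x = M.app g x) → f = g
  K : ∀ {σ τ : Ty} (x : M.D σ) (y : M.D τ), M.app (M.app (M.con (Con.K σ τ)) x) y = x
  S : ∀ {ρ σ τ : Ty} (x : M.D (ρ ⇒ σ ⇒ τ)) (y : M.D (ρ ⇒ σ)) (z : M.D ρ),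
    M.app (M.app (M.app (M.con (Con.S ρ σ τ)) x) y) z = M.app (M.app x z) (M.app y z)
  R_zero : ∀ (x : M.D Ty.nat) (f : M.D (Ty.nat ⇒ Ty.nat ⇒ Ty.nat)),
    M.app (M.app (M.app (M.con Con.R) (M.con Con.zero)) x) f = x
  R_succ : ∀ (n x : M.D Ty.nat) (f : M.D (Ty.nat ⇒ Ty.nat ⇒ Ty.nat)),
    M.app (M.app (M.app (M.con Con.R) (M.app (M.con Con.succ) n)) x) f =
      M.app (M.app f (M.app (M.app (M.app (M.con Con.R) n) x) f)) n
  succ_ne_zero : ∀ n : M.D Ty.nat, M.app (M.con Con.succ) n ≠ M.con Con.zero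
  succ_inj : ∀ m n : M.D Ty.nat, M.app (M.con Con.succ) m = M.app (M.con Con.succ) n → m = n
  /-- Induction for implications between equations. -/
  ind : ∀ f g h k : M.D Ty.one,
    (M.app f (M.con Con.zero) = M.app g (M.con Con.zero) →
      M.app h (M.con Con.zero) = M.app k (M.con Con.zero)) →
    (∀ n, (M.app f n = M.app g n → M.app h n = M.app k n) →
      M.app f (M.app (M.con Con.succ) n) = M.app g (M.app (M.con Con.succ) n) →
        M.app h (M.app (M.con Con.succ) n) = M.app k (M.app (M.con Con.succ) n)) →
    ∀ n, M.app f n = M.app g n → M.app h n = M.app k n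

/-! ## The term model of a Henkin theory -/

namespace HenkinTheory

variable (𝒯 : HenkinTheory)

theorem mp₁ {n : ℕ} {A B : Fm (ctx n)} (h : Prov [A] B) (hA : 𝒯.T A) : 𝒯.T B :=
  𝒯.mp (𝒯.ofProv (.impI h)) hA

theorem mp₂ {n : ℕ} {A B C : Fm (ctx n)} (h : Prov [A, B] C) (hA : 𝒯.T A) (hB : 𝒯.T B) : 𝒯.T C :=
  𝒯.mp (𝒯.mp (𝒯.ofProv (.impI (.impI h))) hB) hA

theorem imp_iff {n : ℕ} (A B : Fm (ctx n)) : 𝒯.T (A.imp B) ↔ (𝒯.T A → 𝒯.T B) := by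
  refine ⟨𝒯.mp, fun h => ?_⟩
  rcases 𝒯.complete A with hA | hA
  · exact 𝒯.mp₁ (.impI (.hyp (by simp))) (h hA)
  · exact 𝒯.mp₁ (.impI (.exfalso _ (.impE (.hyp (.tail _ (.head _))) (.hyp (.head _))))) hA

theorem all_iff {n : ℕ} {σ : Ty} (B : Fm (σ :: ctx n)) :
    𝒯.T (Fm.all σ B) ↔
      ∀ (m : ℕ) (h : n ≤ m) (t : Tm (ctx m) σ), 𝒯.T (B.subst (Sub.cons t (up h))) := by
  refine ⟨fun hB m h t => ?_, 𝒯.henkin B⟩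
  rw [← 𝒯.up_iff h] at hB
  have := 𝒯.mp₁ (.allE t (.hyp (.head _))) hB
  rwa [Fm.lift_inst] at this

/-- Provable equality of terms, possibly from different contexts. -/
def setoid (σ : Ty) : Setoid (Σ n, Tm (ctx n) σ) where
  r p q := ∃ m, ∃ (h : p.1 ≤ m) (h' : q.1 ≤ m),
    𝒯.T (eqAt σ (p.2.subst (up h)) (q.2.subst (up h')))
  iseqv := {
    refl := fun p => ⟨p.1, le_rfl, le_rfl, 𝒯.ofProv (.eqAt_refl _)⟩
    symm := fun ⟨m, h, h', e⟩ => ⟨m, h', h, 𝒯.mp₁ (.eqAt_symm (.hyp (.head _))) e⟩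
    trans := by
      rintro p q r ⟨m, h₁, h₂, e⟩ ⟨k, h₃, h₄, e'⟩
      rw [← 𝒯.up_iff (le_max_left m k), eqAt_subst, Tm.up_up, Tm.up_up] at e
      rw [← 𝒯.up_iff (le_max_right m k), eqAt_subst, Tm.up_up, Tm.up_up] at e'
      exact ⟨max m k, _, _,
        𝒯.mp₂ (.eqAt_trans (.hyp (.head _)) (.hyp (.tail _ (.head _)))) e e'⟩ }

def Carrier (σ : Ty) : Type := Quotient (𝒯.setoid σ)

def cls {n : ℕ} {σ : Ty} (t : Tm (ctx n) σ) : 𝒯.Carrier σ := Quotient.mk (𝒯.setoid σ) ⟨n, t⟩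

theorem cls_eq_cls {n : ℕ} {σ : Ty} (s t : Tm (ctx n) σ) : 𝒯.cls s = 𝒯.cls t ↔ 𝒯.T (eqAt σ s t) := by
  refine Quotient.eq.trans ⟨?_, fun h => ⟨n, le_rfl, le_rfl, by rwa [Tm.up_refl, Tm.up_refl]⟩⟩
  rintro ⟨m, h, h', e⟩
  rw [← 𝒯.up_iff h, eqAt_subst]
  exact e

theorem cls_up {n m : ℕ} (h : n ≤ m) {σ : Ty} (t : Tm (ctx n) σ) : 𝒯.cls (t.subst (up h)) = 𝒯.cls t :=
  Quotient.sound ⟨m, le_rfl, h, by rw [Tm.up_refl]; exact 𝒯.ofProv (.eqAt_refl _)⟩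

theorem exists_cls {σ : Ty} (d : 𝒯.Carrier σ) : ∃ (n : ℕ) (t : Tm (ctx n) σ), 𝒯.cls t = d := by
  induction d using Quotient.ind with
  | _ p => exact ⟨p.1, p.2, rfl⟩

theorem exists_cls_ge (n : ℕ) {σ : Ty} (d : 𝒯.Carrier σ) :
    ∃ (m : ℕ) (_ : n ≤ m) (t : Tm (ctx m) σ), 𝒯.cls t = d := by
  obtain ⟨m, t, rfl⟩ := 𝒯.exists_cls d
  exact ⟨max n m, le_max_left n m, _, 𝒯.cls_up (le_max_right n m) t⟩

noncomputable def capp {σ τ : Ty} : 𝒯.Carrier (σ ⇒ τ) → 𝒯.Carrier σ → 𝒯.Carrier τ :=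
  Quotient.map₂ (sa := 𝒯.setoid _) (sb := 𝒯.setoid _) (sc := 𝒯.setoid _)
    (fun p q => ⟨max p.1 q.1,
      p.2.subst (up (le_max_left _ _)) ⬝ q.2.subst (up (le_max_right _ _))⟩) (by
    rintro p p' ⟨m, h₁, h₂, e⟩ q q' ⟨k, h₃, h₄, e'⟩
    have l₁ := le_max_left m k
    have l₂ := le_max_right m k
    rw [← 𝒯.up_iff l₁, eqAt_subst, Tm.up_up, Tm.up_up] at e
    rw [← 𝒯.up_iff l₂, eqAt_subst, Tm.up_up, Tm.up_up] at e'
    refine ⟨max m k, max_le (h₁.trans l₁) (h₃.trans l₂), max_le (h₂.trans l₁) (h₄.trans l₂), ?_⟩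
    simp only [Tm.subst, Tm.up_up]
    exact 𝒯.mp₂ (.eqAt_app (.hyp (.head _)) (.hyp (.tail _ (.head _)))) e e')

theorem capp_cls {n : ℕ} {σ τ : Ty} (s : Tm (ctx n) (σ ⇒ τ)) (t : Tm (ctx n) σ) :
    𝒯.capp (𝒯.cls s) (𝒯.cls t) = 𝒯.cls (s ⬝ t) := by
  refine (𝒯.cls_up (le_max_left n n) (s ⬝ t)).symm.trans ?_ |>.symm
  rfl

/-- The term model. -/
noncomputable def str : Str where
  D := 𝒯.Carrier
  con c := 𝒯.cls (n := 0) (Tm.con c)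
  app := 𝒯.capp

theorem str_con (n : ℕ) {σ : Ty} (c : Con σ) : 𝒯.str.con c = 𝒯.cls (n := n) (Tm.con c) :=
  (𝒯.cls_up (Nat.zero_le n) (Tm.con c)).symm

theorem eval_cls {Γ : List Ty} {m : ℕ} (θ : Sub Γ (ctx m)) {σ : Ty} (t : Tm Γ σ) :
    t.eval (M := 𝒯.str) (fun _ v => 𝒯.cls (θ _ v)) = 𝒯.cls (t.subst θ) := by
  induction t with
  | var v => rfl
  | con c => exact 𝒯.str_con m c
  | app s t hs ht =>
    simp only [Tm.eval, Tm.subst, hs, ht]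
    exact 𝒯.capp_cls _ _

/-- Truth in the term model is membership in the theory. -/
theorem sat_iff {Γ : List Ty} (A : Fm Γ) : ∀ {m : ℕ} (θ : Sub Γ (ctx m)),
    A.Sat (M := 𝒯.str) (fun _ v => 𝒯.cls (θ _ v)) ↔ 𝒯.T (A.subst θ) := by
  induction A with
  | eq s t =>
    intro m θ
    simp only [Fm.Sat, eval_cls]
    exact 𝒯.cls_eq_cls _ _
  | bot => exact fun θ => ⟨False.elim, fun h => 𝒯.not_bot h⟩
  | imp A B hA hB =>
    intro m θ
    simp only [Fm.Sat, Fm.subst, imp_iff, hA, hB]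
  | @all Γ σ B hB =>
    intro m θ
    simp only [Fm.Sat, Fm.subst, all_iff, Fm.subst_lift_cons]
    have key : ∀ (k : ℕ) (h : m ≤ k) (t : Tm (ctx k) σ),
        B.Sat (M := 𝒯.str) (Env.cons (𝒯.cls t) (fun _ v => 𝒯.cls (θ _ v))) ↔
          𝒯.T (B.subst (Sub.cons t (fun _ v => (θ _ v).subst (up h)))) := by
      intro k h t
      rw [← hB]
      have e : (Env.cons (𝒯.cls t) (fun _ v => 𝒯.cls (θ _ v)) : Env 𝒯.str (σ :: Γ)) =
          fun _ v => 𝒯.cls (Sub.cons t (fun _ v => (θ _ v).subst (up h)) _ v) := by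
        funext τ v
        cases v with
        | z => rfl
        | s v => exact (𝒯.cls_up h _).symm
      rw [e]
    constructor
    · exact fun H k h t => (key k h t).1 (H _)
    · intro H d
      -- An element may be named only by a term of a later context, which is why the Henkin property
      -- quantifies over all later contexts.
      obtain ⟨k, h, t, rfl⟩ := 𝒯.exists_cls_ge m d
      exact (key k h t).2 (H k h t)

/-- The assignment of its class to each variable. -/
def canon (m : ℕ) : Env 𝒯.str (ctx m) := fun _ v => 𝒯.cls (Tm.var v)

/-- Provable formulas are true in the term model. -/
theorem sat_of_prov {m : ℕ} {A : Fm (ctx m)} (h : Prov [] A) : A.Sat (𝒯.canon m) := by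
  refine (𝒯.sat_iff A (fun _ v => Tm.var v)).2 ?_
  rw [Fm.subst_var]; exact 𝒯.ofProv h

theorem eval_canon {m : ℕ} {σ : Ty} (t : Tm (ctx m) σ) : t.eval (𝒯.canon m) = 𝒯.cls t :=
  (𝒯.eval_cls _ t).trans (congrArg 𝒯.cls (Tm.subst_var t))

end HenkinTheory

/-! ### Evaluation under substitution and renaming -/

theorem Tm.eval_subst {M : Str} {Γ Δ : List Ty} (θ : Sub Γ Δ) (ρ : Env M Δ) {σ : Ty}
    (t : Tm Γ σ) : (t.subst θ).eval ρ = t.eval (fun _ v => (θ _ v).eval ρ) := by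
  induction t with
  | var v => rfl
  | con c => rfl
  | app s t hs ht => simp only [Tm.subst, Tm.eval, hs, ht]

theorem Tm.eval_rename {M : Str} {Γ Δ : List Ty} (r : Ren Γ Δ) (ρ : Env M Δ) {σ : Ty}
    (t : Tm Γ σ) : (t.rename r).eval ρ = t.eval (fun _ v => ρ _ (r _ v)) := by
  rw [Tm.rename_eq_subst, Tm.eval_subst]; rfl

@[simp] theorem Tm.eval_wk {M : Str} {Γ : List Ty} (ρ : Env M Γ) {σ τ : Ty} (d : M.D τ)
    (t : Tm Γ σ) : t.wk.eval (Env.cons d ρ) = t.eval ρ :=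
  Tm.eval_rename _ _ t

@[simp] theorem Tm.eval_ofClosed {M : Str} {Γ : List Ty} (ρ : Env M Γ) {σ : Ty}
    (t : Tm [] σ) : (t.ofClosed : Tm Γ σ).eval ρ = t.eval (Env.nil M) := by
  refine (Tm.eval_rename _ _ t).trans ?_
  congr 1; funext τ v
  cases v

namespace HenkinTheory

variable (𝒯 : HenkinTheory)

theorem exists_cls₂ (n : ℕ) {σ τ : Ty} (d : 𝒯.Carrier σ) (e : 𝒯.Carrier τ) :
    ∃ (m : ℕ) (_ : n ≤ m) (s : Tm (ctx m) σ) (t : Tm (ctx m) τ), 𝒯.cls s = d ∧ 𝒯.cls t = e := by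
  obtain ⟨m, h, s, rfl⟩ := 𝒯.exists_cls_ge n d
  obtain ⟨k, h', t, rfl⟩ := 𝒯.exists_cls_ge m e
  exact ⟨k, h.trans h', _, t, 𝒯.cls_up h' s, rfl⟩

theorem exists_cls₃ {σ τ υ : Ty} (d : 𝒯.Carrier σ) (e : 𝒯.Carrier τ) (f : 𝒯.Carrier υ) :
    ∃ (m : ℕ) (s : Tm (ctx m) σ) (t : Tm (ctx m) τ) (u : Tm (ctx m) υ),
      𝒯.cls s = d ∧ 𝒯.cls t = e ∧ 𝒯.cls u = f := by
  obtain ⟨m, _, s, t, rfl, rfl⟩ := 𝒯.exists_cls₂ 0 d e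
  obtain ⟨k, h', u, rfl⟩ := 𝒯.exists_cls_ge m f
  exact ⟨k, _, _, u, 𝒯.cls_up h' s, 𝒯.cls_up h' t, rfl⟩

theorem exists_cls₄ {σ τ υ ω : Ty} (d : 𝒯.Carrier σ) (e : 𝒯.Carrier τ) (f : 𝒯.Carrier υ)
    (g : 𝒯.Carrier ω) :
    ∃ (m : ℕ) (s : Tm (ctx m) σ) (t : Tm (ctx m) τ) (u : Tm (ctx m) υ) (w : Tm (ctx m) ω),
      𝒯.cls s = d ∧ 𝒯.cls t = e ∧ 𝒯.cls u = f ∧ 𝒯.cls w = g := by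
  obtain ⟨m, _, s, t, rfl, rfl⟩ := 𝒯.exists_cls₂ 0 d e
  obtain ⟨k, h, u, w, rfl, rfl⟩ := 𝒯.exists_cls₂ m f g
  exact ⟨k, _, _, u, w, 𝒯.cls_up h s, 𝒯.cls_up h t, rfl, rfl⟩

theorem str_ext {σ τ : Ty} {f g : 𝒯.Carrier (σ ⇒ τ)} (h : ∀ x, 𝒯.capp f x = 𝒯.capp g x) :
    f = g := by
  obtain ⟨m, _, s, t, rfl, rfl⟩ := 𝒯.exists_cls₂ 0 f g
  rw [cls_eq_cls, eqAt, all_iff]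
  intro k hk u
  have := h (𝒯.cls u)
  rw [← 𝒯.cls_up hk s, ← 𝒯.cls_up hk t, capp_cls, capp_cls, cls_eq_cls] at this
  rw [eqAt_subst]
  simp only [Tm.subst, Tm.wk_subst]
  exact this

theorem str_app {n : ℕ} {σ τ : Ty} (s : Tm (ctx n) (σ ⇒ τ)) (t : Tm (ctx n) σ) :
    𝒯.str.app (𝒯.cls s) (𝒯.cls t) = 𝒯.cls (s ⬝ t) :=
  𝒯.capp_cls s t

theorem succSub_wk {Γ : List Ty} {σ : Ty} (t : Tm Γ σ) : t.wk.subst (succSub Γ) = t.wk := by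
  rw [Tm.wk_subst, Tm.wk, Tm.rename_eq_subst]; rfl

theorem str_ind (f g h k : 𝒯.str.D Ty.one)
    (h₀ : 𝒯.str.app f (𝒯.str.con Con.zero) = 𝒯.str.app g (𝒯.str.con Con.zero) →
      𝒯.str.app h (𝒯.str.con Con.zero) = 𝒯.str.app k (𝒯.str.con Con.zero))
    (hs : ∀ n, (𝒯.str.app f n = 𝒯.str.app g n → 𝒯.str.app h n = 𝒯.str.app k n) →
      𝒯.str.app f (𝒯.str.app (𝒯.str.con Con.succ) n) =
        𝒯.str.app g (𝒯.str.app (𝒯.str.con Con.succ) n) →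
      𝒯.str.app h (𝒯.str.app (𝒯.str.con Con.succ) n) =
        𝒯.str.app k (𝒯.str.app (𝒯.str.con Con.succ) n)) :
    ∀ n, 𝒯.str.app f n = 𝒯.str.app g n → 𝒯.str.app h n = 𝒯.str.app k n := by
  obtain ⟨m, f, g, h, k, rfl, rfl, rfl, rfl⟩ := 𝒯.exists_cls₄ f g h k
  have := 𝒯.sat_of_prov (.ax (.qfInd
    ((Fm.eq (f.wk ⬝ v0) (g.wk ⬝ v0)).imp (Fm.eq (h.wk ⬝ v0) (k.wk ⬝ v0))) ⟨trivial, trivial⟩))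
  simp only [Fm.inst, Fm.subst, Tm.subst, Tm.subst_single_wk, succSub_wk, Fm.Sat, Tm.eval,
    Tm.eval_wk, eval_canon, Sub.single] at this
  rw [𝒯.str_con m] at h₀
  exact this h₀ hs

instance : 𝒯.str.IsModel where
  ext := 𝒯.str_ext
  K x y := by
    obtain ⟨m, _, s, t, rfl, rfl⟩ := 𝒯.exists_cls₂ 0 x y
    rw [𝒯.str_con m]
    rw [str_app, str_app]
    exact (𝒯.cls_eq_cls _ _).2 <| 𝒯.ofProv (.ax (.K s t))
  S x y z := by
    obtain ⟨m, s, t, u, rfl, rfl, rfl⟩ := 𝒯.exists_cls₃ x y z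
    rw [𝒯.str_con m]
    simp only [str_app]
    exact (𝒯.cls_eq_cls _ _).2 <| 𝒯.ofProv (.ax (.S s t u))
  R_zero x f := by
    obtain ⟨m, _, s, t, rfl, rfl⟩ := 𝒯.exists_cls₂ 0 x f
    rw [𝒯.str_con m, 𝒯.str_con m]
    simp only [str_app]
    exact (𝒯.cls_eq_cls _ _).2 <| 𝒯.ofProv (.ax (.R_zero s t))
  R_succ n x f := by
    obtain ⟨m, r, s, t, rfl, rfl, rfl⟩ := 𝒯.exists_cls₃ n x f
    rw [𝒯.str_con m, 𝒯.str_con m]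
    simp only [str_app]
    exact (𝒯.cls_eq_cls _ _).2 <| 𝒯.ofProv (.ax (.R_succ r s t))
  succ_ne_zero n := by
    obtain ⟨m, t, rfl⟩ := 𝒯.exists_cls n
    rw [𝒯.str_con m, 𝒯.str_con m]
    rw [str_app]
    exact fun h => 𝒯.not_bot
      (𝒯.mp (𝒯.ofProv (.ax (.succ_ne_zero t))) ((𝒯.cls_eq_cls _ _).1 h))
  succ_inj a b := by
    obtain ⟨m, _, s, t, rfl, rfl⟩ := 𝒯.exists_cls₂ 0 a b
    rw [𝒯.str_con m]
    rw [str_app, str_app]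
    exact fun h => (𝒯.cls_eq_cls _ _).2
      (𝒯.mp (𝒯.ofProv (.ax (.succ_inj s t))) ((𝒯.cls_eq_cls _ _).1 h))
  ind := 𝒯.str_ind

end HenkinTheory

/-- Completeness: what is true in all models is provable. -/
theorem provable_of_models {A : Fm []}
    (h : ∀ (M : Str) [M.IsModel], A.Sat (Env.nil M)) : Provable A := by
  by_contra hA
  obtain ⟨𝒯, h𝒯⟩ := exists_henkinTheory (H := [A.neg]) (fun hp => hA (.raa hp))
  have h₁ := h𝒯 A.neg (.head _)
  rw [← Fm.subst_var A.neg] at h₁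
  have h₂ := (𝒯.sat_iff (m := 0) A.neg (fun _ v => Tm.var v)).2 h₁
  have e : (fun _ v => 𝒯.cls (n := 0) (Tm.var v) : Env 𝒯.str []) = Env.nil 𝒯.str := by
    funext σ v; cases v
  exact Eq.mp (congrArg (fun ρ => Fm.Sat ρ A.neg) e) h₂ (h 𝒯.str)


/-! ## Arithmetic in a model -/

@[simp] theorem Env.cons_z {M : Str} {Γ : List Ty} {τ : Ty} (d : M.D τ) (ρ : Env M Γ) :
    Env.cons d ρ τ Var.z = d := rfl

@[simp] theorem Env.cons_s {M : Str} {Γ : List Ty} {σ τ : Ty} (d : M.D τ) (ρ : Env M Γ)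
    (v : Var Γ σ) : Env.cons d ρ σ (Var.s v) = ρ σ v := rfl

@[simp] theorem Tm.eval_var {M : Str} {Γ : List Ty} {σ : Ty} (ρ : Env M Γ) (v : Var Γ σ) :
    (Tm.var v).eval ρ = ρ σ v := rfl

@[simp] theorem Tm.eval_app {M : Str} {Γ : List Ty} {σ τ : Ty} (ρ : Env M Γ)
    (s : Tm Γ (σ ⇒ τ)) (t : Tm Γ σ) : (s ⬝ t).eval ρ = M.app (s.eval ρ) (t.eval ρ) := rfl

variable {M : Str}

/-- The numbers of a model. -/
abbrev Str.N (M : Str) : Type := M.D Ty.nat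

instance : Zero M.N := ⟨M.con Con.zero⟩

/-- The successor function of a model. -/
def Str.S (n : M.N) : M.N := M.app (M.con Con.succ) n

/-- The recursor of a model. -/
def Str.R (n x : M.N) (f : M.D (Ty.nat ⇒ Ty.nat ⇒ Ty.nat)) : M.N :=
  M.app (M.app (M.app (M.con Con.R) n) x) f

open Str (S R)

section Eval

variable {Γ : List Ty} (ρ : Env M Γ)

@[simp] theorem eval_zero : (zero : Tm Γ Ty.nat).eval ρ = 0 := rfl

@[simp] theorem eval_succ (t : Tm Γ Ty.nat) : (succ t).eval ρ = S (t.eval ρ) := rfl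

@[simp] theorem eval_one : (one : Tm Γ Ty.nat).eval ρ = S 0 := rfl

@[simp] theorem eval_recur (n x : Tm Γ Ty.nat) (f : Tm Γ (Ty.nat ⇒ Ty.nat ⇒ Ty.nat)) :
    (recur n x f).eval ρ = R (n.eval ρ) (x.eval ρ) (f.eval ρ) := rfl

end Eval

section Sat

variable {Γ : List Ty} (ρ : Env M Γ)

@[simp] theorem sat_eq (s t : Tm Γ Ty.nat) : (Fm.eq s t).Sat ρ ↔ s.eval ρ = t.eval ρ := Iff.rfl

@[simp] theorem sat_imp (A B : Fm Γ) : (A.imp B).Sat ρ ↔ (A.Sat ρ → B.Sat ρ) := Iff.rfl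

@[simp] theorem sat_all {σ : Ty} (A : Fm (σ :: Γ)) :
    (Fm.all σ A).Sat ρ ↔ ∀ d, A.Sat (Env.cons d ρ) := Iff.rfl

@[simp] theorem sat_neg (A : Fm Γ) : A.neg.Sat ρ ↔ ¬ A.Sat ρ := Iff.rfl

@[simp] theorem sat_and (A B : Fm Γ) : (A.and B).Sat ρ ↔ A.Sat ρ ∧ B.Sat ρ := by
  simp [Fm.and]

@[simp] theorem sat_or (A B : Fm Γ) : (A.or B).Sat ρ ↔ A.Sat ρ ∨ B.Sat ρ := by
  simp [Fm.or, or_iff_not_imp_left]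

@[simp] theorem sat_iff (A B : Fm Γ) : (A.iff B).Sat ρ ↔ (A.Sat ρ ↔ B.Sat ρ) := by
  simp [Fm.iff, iff_def]

@[simp] theorem sat_ex {σ : Ty} (A : Fm (σ :: Γ)) :
    (Fm.ex σ A).Sat ρ ↔ ∃ d, A.Sat (Env.cons d ρ) := by
  simp [Fm.ex]

end Sat
variable [M.IsModel]

theorem Str.ext {σ τ : Ty} {f g : M.D (σ ⇒ τ)} (h : ∀ x, M.app f x = M.app g x) : f = g :=
  Str.IsModel.ext h

theorem Tm.eval_lam_aux {Γ : List Ty} {σ : Ty} (ρ : Env M Γ) (x : M.D σ) :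
    {τ : Ty} → (t : Tm (σ :: Γ) τ) → M.app ((lam t).eval ρ) x = t.eval (Env.cons x ρ)
  | _, Tm.var Var.z => (Str.IsModel.S _ _ _).trans (Str.IsModel.K _ _)
  | _, Tm.var (Var.s _) => Str.IsModel.K _ _
  | _, Tm.con _ => Str.IsModel.K _ _
  | _, Tm.app s t => (Str.IsModel.S _ _ _).trans
      (congrArg₂ M.app (Tm.eval_lam_aux ρ x s) (Tm.eval_lam_aux ρ x t))

@[simp] theorem Tm.eval_lam {Γ : List Ty} {σ τ : Ty} (ρ : Env M Γ) (t : Tm (σ :: Γ) τ)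
    (x : M.D σ) : M.app ((lam t).eval ρ) x = t.eval (Env.cons x ρ) :=
  Tm.eval_lam_aux ρ x t

/-- The step function is evaluated in the empty environment; extensionality identifies it with its
copy in any other context, as `eval_add` requires. -/
instance : Add M.N := ⟨fun x y => Str.R y x ((lam (lam (succ v1))).eval (Env.nil M))⟩

def Str.P (n : M.N) : M.N := Str.R n 0 ((lam (lam v0)).eval (Env.nil M))

instance : _root_.Sub M.N := ⟨fun x y => Str.R y x ((lam (lam (pred v1))).eval (Env.nil M))⟩

open Str (P)

@[simp] theorem R_zero (x : M.N) (f : M.D (Ty.nat ⇒ Ty.nat ⇒ Ty.nat)) : R 0 x f = x :=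
  Str.IsModel.R_zero x f

@[simp] theorem R_succ (n x : M.N) (f : M.D (Ty.nat ⇒ Ty.nat ⇒ Ty.nat)) :
    R (S n) x f = M.app (M.app f (R n x f)) n :=
  Str.IsModel.R_succ n x f

@[simp] theorem S_ne_zero (n : M.N) : S n ≠ 0 := Str.IsModel.succ_ne_zero n

@[simp] theorem zero_ne_S (n : M.N) : 0 ≠ S n := (S_ne_zero n).symm

@[simp] theorem S_inj {m n : M.N} : S m = S n ↔ m = n :=
  ⟨Str.IsModel.succ_inj m n, congrArg _⟩

section Eval

variable {Γ : List Ty} (ρ : Env M Γ)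

@[simp] theorem eval_add (s t : Tm Γ Ty.nat) : (add s t).eval ρ = s.eval ρ + t.eval ρ := by
  refine congrArg (R (t.eval ρ) (s.eval ρ)) (Str.ext fun x => Str.ext fun y => ?_)
  simp

@[simp] theorem eval_pred (t : Tm Γ Ty.nat) : (pred t).eval ρ = P (t.eval ρ) := by
  refine congrArg (R (t.eval ρ) 0) (Str.ext fun x => Str.ext fun y => ?_)
  simp

@[simp] theorem eval_monus (s t : Tm Γ Ty.nat) : (monus s t).eval ρ = s.eval ρ - t.eval ρ := by
  refine congrArg (R (t.eval ρ) (s.eval ρ)) (Str.ext fun x => Str.ext fun y => ?_)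
  simp

end Eval

@[simp] theorem add_zero' (x : M.N) : x + 0 = x := R_zero _ _

@[simp] theorem add_S (x y : M.N) : x + S y = S (x + y) := by
  refine (R_succ _ _ _).trans ?_
  simp; rfl

@[simp] theorem P_zero : P (0 : M.N) = 0 := R_zero _ _

@[simp] theorem P_S (x : M.N) : P (S x) = x := by
  refine (R_succ _ _ _).trans ?_
  simp

@[simp] theorem sub_zero' (x : M.N) : x - 0 = x := R_zero _ _

theorem sub_S (x y : M.N) : x - S y = P (x - y) := by
  refine (R_succ _ _ _).trans ?_
  simp; rfl

/-! ### Representable functions and induction -/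

/-- `F` is given by an element of the model. -/
class Rep {σ τ : Ty} (F : M.D σ → M.D τ) : Prop where
  out : ∃ f : M.D (σ ⇒ τ), ∀ x, M.app f x = F x

instance Rep.const {σ τ : Ty} (c : M.D τ) : Rep (fun _ : M.D σ => c) :=
  ⟨⟨M.app (M.con (Con.K τ σ)) c, fun _ => Str.IsModel.K _ _⟩⟩

instance Rep.id {σ : Ty} : Rep (fun x : M.D σ => x) :=
  ⟨⟨(lam v0).eval (Env.nil M), fun _ => by simp⟩⟩

instance Rep.app {ρ σ τ : Ty} (F : M.D ρ → M.D (σ ⇒ τ)) (G : M.D ρ → M.D σ) [hF : Rep F]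
    [hG : Rep G] : Rep (fun x => M.app (F x) (G x)) := by
  obtain ⟨f, hf⟩ := hF
  obtain ⟨g, hg⟩ := hG
  exact ⟨M.app (M.app (M.con (Con.S _ _ _)) f) g, fun x => by
    rw [Str.IsModel.S, hf, hg]⟩

section

variable {σ : Ty} (F G : M.D σ → M.N) [hF : Rep F] [hG : Rep G]

instance Rep.succ : Rep (fun x => S (F x)) := inferInstanceAs (Rep (fun x => M.app _ (F x)))

instance Rep.recur (f : M.D σ → M.D (Ty.nat ⇒ Ty.nat ⇒ Ty.nat)) [Rep f] :
    Rep (fun x => R (F x) (G x) (f x)) :=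
  inferInstanceAs (Rep (fun x => M.app (M.app (M.app _ (F x)) (G x)) (f x)))

instance Rep.pred : Rep (fun x => P (F x)) := inferInstanceAs (Rep (fun x => Str.R (F x) 0 _))

instance Rep.succ_eta : Rep (S : M.N → M.N) := Rep.succ (fun x => x)

instance Rep.pred_eta : Rep (P : M.N → M.N) := Rep.pred (fun x => x)

instance Rep.add : Rep (fun x => F x + G x) := inferInstanceAs (Rep (fun x => Str.R (G x) (F x) _))

instance Rep.sub : Rep (fun x => F x - G x) := inferInstanceAs (Rep (fun x => Str.R (G x) (F x) _))

instance Rep.add_left (c : M.N) : Rep (fun x : M.N => c + x) := Rep.add (fun _ => c) (fun x => x)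

instance Rep.sub_left (c : M.N) : Rep (fun x : M.N => c - x) := Rep.sub (fun _ => c) (fun x => x)

end

theorem ind_imp (F G H K : M.N → M.N) [hF : Rep F] [hG : Rep G] [hH : Rep H] [hK : Rep K]
    (h₀ : F 0 = G 0 → H 0 = K 0)
    (hs : ∀ n, (F n = G n → H n = K n) → F (S n) = G (S n) → H (S n) = K (S n)) (n : M.N) :
    F n = G n → H n = K n := by
  obtain ⟨f, hf⟩ := hF
  obtain ⟨g, hg⟩ := hG
  obtain ⟨h, hh⟩ := hH
  obtain ⟨k, hk⟩ := hK
  have := Str.IsModel.ind f g h k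
  simp only [hf, hg, hh, hk] at this
  exact this h₀ hs n

theorem ind_eq (F G : M.N → M.N) [Rep F] [Rep G] (h₀ : F 0 = G 0)
    (hs : ∀ n, F n = G n → F (S n) = G (S n)) (n : M.N) : F n = G n :=
  ind_imp (fun _ => 0) (fun _ => 0) F G (fun _ => h₀) (fun n h _ => hs n (h rfl)) n rfl

theorem eq_zero_or_S (n : M.N) : n = 0 ∨ ∃ m, n = S m := by
  by_cases h : n = 0
  · exact .inl h
  -- Disjunctions are not yet available to induction, so it proves m = n → m = S (P m): the case 0
  -- contradicts n ≠ 0, and successors satisfy the conclusion outright.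
  · exact .inr ⟨P n, ind_imp (fun m => m) (fun _ => n) (fun m => m) (fun m => S (P m))
      (fun h' => absurd h'.symm h) (fun m _ _ => by simp) n rfl⟩


/-! ### Laws of addition and truncated subtraction -/

theorem zero_add' (x : M.N) : 0 + x = x :=
  ind_eq (fun x => 0 + x) (fun x => x) (by simp) (fun n h => by simp [h]) x

@[simp] theorem S_add (x y : M.N) : S x + y = S (x + y) :=
  ind_eq (fun y => S x + y) (fun y => S (x + y)) (by simp) (fun n h => by simp [h]) y

theorem add_comm' (x y : M.N) : x + y = y + x :=
  ind_eq (fun y => x + y) (fun y => y + x) (by simp [zero_add']) (fun n h => by simp [h]) y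

theorem zero_sub' (x : M.N) : 0 - x = 0 :=
  ind_eq (fun x => 0 - x) (fun _ => 0) (by simp) (fun n h => by simp [sub_S, h]) x

@[simp] theorem S_sub_S (x y : M.N) : S x - S y = x - y :=
  ind_eq (fun y => S x - S y) (fun y => x - y) (by simp [sub_S])
    (fun n h => by rw [sub_S, h, sub_S]) y

@[simp] theorem sub_self' (x : M.N) : x - x = 0 :=
  ind_eq (fun x => x - x) (fun _ => 0) (by simp) (fun n h => by simp [h]) x

@[simp] theorem add_sub_left (x y : M.N) : x + y - x = y :=
  ind_eq (fun x => x + y - x) (fun _ => y) (by simp [zero_add']) (fun n h => by simp [h]) x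

@[simp] theorem sub_add_left (x y : M.N) : x - (x + y) = 0 :=
  ind_eq (fun x => x - (x + y)) (fun _ => 0) (by simp [zero_sub']) (fun n h => by simp [h]) x

theorem sub_eq_zero_of_S {x y : M.N} (h : S x - y = 0) : x - y = 0 := by
  rw [← S_sub_S, sub_S, h, P_zero]

/-- Here induction must carry a hypothesis before equations can be turned into zero sets, so
induction for implications between equations is used. -/
theorem add_sub_of_sub_eq_zero (x y : M.N) : x - y = 0 → x + (y - x) = y := by
  refine ind_imp (fun x => x - y) (fun _ => 0) (fun x => x + (y - x)) (fun _ => y)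
    (fun _ => by simp [zero_add']) (fun x ih h => ?_) x
  have ih := ih (sub_eq_zero_of_S h)
  -- If y - x were 0, the induction hypothesis would give x = y, and then S x - y = 0 would say that
  -- 1 = 0.
  rcases eq_zero_or_S (y - x) with h' | ⟨d, h'⟩
  · rw [h', add_zero'] at ih
    rw [← ih] at h
    have h₁ := add_sub_left x (S 0)
    rw [add_S, add_zero', h] at h₁
    exact absurd h₁ (zero_ne_S 0)
  · rw [sub_S, h', P_S, S_add, ← add_S, ← h', ih]

theorem add_eq_zero' {x y : M.N} : x + y = 0 ↔ x = 0 ∧ y = 0 := by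
  refine ⟨fun h => ?_, fun h => by rw [h.1, h.2, add_zero']⟩
  rcases eq_zero_or_S y with rfl | ⟨d, rfl⟩
  · simpa using h
  · simp at h

/-- This turns every equation into a zero set, so that `Dec` is closed under propositional
connectives and `ind` applies to them. -/
theorem eq_iff_sub (x y : M.N) : x = y ↔ (x - y) + (y - x) = 0 := by
  refine ⟨fun h => by simp [h], fun h => ?_⟩
  have h := add_eq_zero'.1 h
  have h' := add_sub_of_sub_eq_zero x y h.1
  rwa [h.2, add_zero'] at h'

/-! ### Decidable predicates -/

/-- `0` if `n ≠ 0`, and `x` if `n = 0`. -/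
def ifz (n x : M.N) : M.N := R n x ((lam (lam zero)).eval (Env.nil M))

@[simp] theorem ifz_zero (x : M.N) : ifz 0 x = x := R_zero _ _

@[simp] theorem ifz_S (n x : M.N) : ifz (S n) x = 0 := by simp [ifz]

theorem ifz_eq_zero {n x : M.N} : ifz n x = 0 ↔ (n = 0 → x = 0) := by
  rcases eq_zero_or_S n with rfl | ⟨d, rfl⟩ <;> simp

instance Rep.ifz {σ : Ty} (F G : M.D σ → M.N) [Rep F] [Rep G] : Rep (fun x => ifz (F x) (G x)) :=
  inferInstanceAs (Rep (fun x => Str.R (F x) (G x) _))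

/-- `A` is the set of zeros of an element of the model. -/
class Dec {σ : Ty} (A : M.D σ → Prop) : Prop where
  out : ∃ F : M.D σ → M.N, Rep F ∧ ∀ n, A n ↔ F n = 0

section

variable {σ : Ty} (A B : M.D σ → Prop) [hA : Dec A] [hB : Dec B]

instance Dec.eq (F G : M.D σ → M.N) [Rep F] [Rep G] : Dec (fun x => F x = G x) :=
  ⟨⟨fun x => (F x - G x) + (G x - F x), inferInstance, fun _ => eq_iff_sub _ _⟩⟩

instance Dec.const (p : Prop) : Dec (fun _ : M.D σ => p) := by
  by_cases hp : p
  · exact ⟨⟨fun _ => 0, inferInstance, fun _ => by simp [hp]⟩⟩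
  · exact ⟨⟨fun _ => S 0, inferInstance, fun _ => by simp [hp]⟩⟩

instance Dec.imp : Dec (fun x => A x → B x) := by
  obtain ⟨F, hF, h⟩ := hA
  obtain ⟨G, hG, h'⟩ := hB
  exact ⟨⟨fun x => HORM.ifz (F x) (G x), inferInstance, fun x => by rw [ifz_eq_zero, h, h']⟩⟩

instance Dec.not : Dec (fun x => ¬ A x) := Dec.imp A (fun _ => False)

instance Dec.or : Dec (fun x => A x ∨ B x) := by
  have := Dec.imp (fun x => ¬ A x) B
  simpa only [or_iff_not_imp_left] using this

end

theorem ind (A : M.N → Prop) [hA : Dec A] (h₀ : A 0) (hs : ∀ n, A n → A (S n)) (n : M.N) : A n := by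
  obtain ⟨F, hF, h⟩ := hA
  simp only [h] at *
  exact ind_eq F (fun _ => 0) h₀ hs n

/-! ### The order -/

instance : LE M.N := ⟨fun x y => x - y = 0⟩

omit [M.IsModel] in
theorem le_def (x y : M.N) : x ≤ y ↔ x - y = 0 := Iff.rfl

theorem le_iff_exists (x y : M.N) : x ≤ y ↔ ∃ d, y = x + d :=
  ⟨fun h => ⟨y - x, (add_sub_of_sub_eq_zero x y h).symm⟩, by
    rintro ⟨d, rfl⟩; exact sub_add_left _ _⟩

theorem add_assoc' (x y z : M.N) : x + y + z = x + (y + z) :=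
  ind_eq (fun z => x + y + z) (fun z => x + (y + z)) (by simp) (fun n h => by simp [h]) z

theorem le_total' (x y : M.N) : x ≤ y ∨ y ≤ x := by
  refine ind (fun y => x - y = 0 ∨ y - x = 0) (by simp [zero_sub']) (fun y h => ?_) y
  rcases h with h | h
  · exact .inl (by rw [sub_S, h, P_zero])
  · have h' := add_sub_of_sub_eq_zero y x h
    rcases eq_zero_or_S (x - y) with h₁ | ⟨d, h₁⟩
    · exact .inl (by rw [sub_S, h₁, P_zero])
    · right
      rw [← h', h₁, add_S, ← S_add, sub_add_left]

noncomputable instance : LinearOrder M.N where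
  le_refl := sub_self'
  le_trans x y z h h' := by
    obtain ⟨d, rfl⟩ := (le_iff_exists _ _).1 h
    obtain ⟨e, rfl⟩ := (le_iff_exists _ _).1 h'
    exact (le_iff_exists _ _).2 ⟨d + e, add_assoc' _ _ _⟩
  le_antisymm x y h h' := (eq_iff_sub x y).2 (add_eq_zero'.2 ⟨h, h'⟩)
  le_total := le_total'
  toDecidableLE := Classical.decRel _

theorem zero_le' (x : M.N) : 0 ≤ x := zero_sub' x

theorem le_add_right' (x y : M.N) : x ≤ x + y := sub_add_left x y

theorem S_le (x y : M.N) : S x ≤ y ↔ x < y := by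
  rw [lt_iff_le_and_ne, le_iff_exists, le_iff_exists]
  constructor
  · rintro ⟨d, rfl⟩
    refine ⟨⟨S d, by simp⟩, fun h => ?_⟩
    have := add_sub_left x (S d)
    rw [add_S, ← S_add, ← h, sub_self'] at this
    exact zero_ne_S _ this
  · rintro ⟨⟨d, rfl⟩, h⟩
    rcases eq_zero_or_S d with rfl | ⟨e, rfl⟩
    · simp at h
    · exact ⟨e, by simp⟩

theorem lt_S (x y : M.N) : x < S y ↔ x ≤ y := by
  rw [← S_le, le_def, le_def, S_sub_S]

@[simp] theorem lt_S_self (x : M.N) : x < S x := (lt_S x x).2 le_rfl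

theorem le_one_iff (x : M.N) : x ≤ S 0 ↔ x = 0 ∨ x = S 0 := by
  rw [le_iff_lt_or_eq, lt_S]
  exact or_congr_left ⟨fun h => le_antisymm h (zero_le' x), fun h => h.le⟩

instance Dec.le {σ : Ty} (F G : M.D σ → M.N) [Rep F] [Rep G] : Dec (fun x => F x ≤ G x) :=
  inferInstanceAs (Dec (fun x => F x - G x = 0))

instance Dec.lt {σ : Ty} (F G : M.D σ → M.N) [Rep F] [Rep G] : Dec (fun x => F x < G x) := by
  simp only [← S_le]
  infer_instance

instance Dec.lt_left (c : M.N) : Dec (LT.lt c) := Dec.lt (fun _ => c) (fun x => x)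


/-! ## Terms for logical operations

A term `t` of type `0` is used as a truth value: it is true if its value is `0`. -/

section Terms

variable {Γ : List Ty}

/-- `x` if `a = 0`, and `y` otherwise. -/
def condT (a x y : Tm Γ Ty.nat) : Tm Γ Ty.nat := recur a x (lam (lam y.wk.wk))

def notT (a : Tm Γ Ty.nat) : Tm Γ Ty.nat := condT a one zero

def impT (a b : Tm Γ Ty.nat) : Tm Γ Ty.nat := condT a b zero

def eqT (a b : Tm Γ Ty.nat) : Tm Γ Ty.nat := add (monus a b) (monus b a)

def ltT (a b : Tm Γ Ty.nat) : Tm Γ Ty.nat := monus (succ a) b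

/-- `∃ x < n, a x`. -/
def bexT (n : Tm Γ Ty.nat) (a : Tm (Ty.nat :: Γ) Ty.nat) : Tm Γ Ty.nat :=
  recur n one (lam (lam (condT ((lam a).wk.wk ⬝ v0) zero v1)))

/-- `∃ x, a x`, where `φ` is as in `(∃²)`. -/
def exT (φ : Tm Γ (Ty.one ⇒ Ty.nat)) (a : Tm (Ty.nat :: Γ) Ty.nat) : Tm Γ Ty.nat := φ ⬝ lam a

/-- `∀ x, a x`, where `φ` is as in `(∃²)`. -/
def allT (φ : Tm Γ (Ty.one ⇒ Ty.nat)) (a : Tm (Ty.nat :: Γ) Ty.nat) : Tm Γ Ty.nat :=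
  notT (exT φ (notT a))

/-- The recursion half (n + 1) = n - half n avoids a case distinction on parity. -/
def halfT (n : Tm Γ Ty.nat) : Tm Γ Ty.nat := recur n zero (lam (lam (monus v0 v1)))

/-- The string without its last bit. -/
def parT (n : Tm Γ Ty.nat) : Tm Γ Ty.nat := halfT (pred n)

/-- The string `s` without its last `j` bits. -/
def ancT (s j : Tm Γ Ty.nat) : Tm Γ Ty.nat := recur j s (lam (lam (parT v1)))

/-- The string `s` extends `σ`. -/
def extT (σ s : Tm Γ Ty.nat) : Tm Γ Ty.nat := bexT (succ s) (eqT (ancT s.wk v0) σ.wk)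

end Terms

/-- The property of `φ` in `(∃²)`. -/
def IsE2 (φ : M.D (Ty.one ⇒ Ty.nat)) : Prop :=
  ∀ g : M.D Ty.one, (∃ x, M.app g x = 0) ↔ M.app φ g = 0

section Eval

variable {Γ : List Ty} (ρ : Env M Γ)

open Classical in
@[simp] theorem eval_condT (a x y : Tm Γ Ty.nat) :
    (condT a x y).eval ρ = if a.eval ρ = 0 then x.eval ρ else y.eval ρ := by
  rw [condT, eval_recur]
  rcases eq_zero_or_S (a.eval ρ) with h | ⟨d, h⟩ <;> simp [h]

theorem eval_notT (a : Tm Γ Ty.nat) : (notT a).eval ρ = 0 ↔ ¬ a.eval ρ = 0 := by simp [notT]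

theorem eval_impT (a b : Tm Γ Ty.nat) :
    (impT a b).eval ρ = 0 ↔ (a.eval ρ = 0 → b.eval ρ = 0) := by
  simp only [impT, eval_condT, eval_zero]; split_ifs <;> simp_all

theorem eval_add_eq_zero (a b : Tm Γ Ty.nat) :
    (add a b).eval ρ = 0 ↔ a.eval ρ = 0 ∧ b.eval ρ = 0 := by
  rw [eval_add, add_eq_zero']

theorem eval_eqT (a b : Tm Γ Ty.nat) : (eqT a b).eval ρ = 0 ↔ a.eval ρ = b.eval ρ := by
  rw [eqT, eval_add, eval_monus, eval_monus]; exact (eq_iff_sub _ _).symm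

theorem eval_ltT (a b : Tm Γ Ty.nat) : (ltT a b).eval ρ = 0 ↔ a.eval ρ < b.eval ρ := by
  rw [ltT, eval_monus, eval_succ, ← S_le, le_def]

theorem eval_bexT (n : Tm Γ Ty.nat) (a : Tm (Ty.nat :: Γ) Ty.nat) :
    (bexT n a).eval ρ = 0 ↔ ∃ x, x < n.eval ρ ∧ a.eval (Env.cons x ρ) = 0 := by
  set b : M.D (Ty.nat ⇒ Ty.nat ⇒ Ty.nat) :=
    (lam (lam (condT ((lam a).wk.wk ⬝ v0) zero v1))).eval ρ with hb
  have hb' : ∀ n, R (S n) (S 0) b = 0 ↔ (a.eval (Env.cons n ρ) = 0 ∨ R n (S 0) b = 0) := by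
    intro n
    rw [R_succ]
    generalize R n (S 0) b = r
    by_cases h : a.eval (Env.cons n ρ) = 0 <;> simp [hb, h]
  have h₁ : ∀ x n, a.eval (Env.cons x ρ) = 0 → x < n → R n (S 0) b = 0 := by
    intro x n hx
    refine ind (fun n => x < n → R n (S 0) b = 0) (fun h => absurd (zero_le' x) (not_le.2 h))
      (fun n ih h => ?_) n
    rw [hb']
    rcases ((lt_S x n).1 h).eq_or_lt with rfl | h'
    exacts [.inl hx, .inr (ih h')]
  have h₂ : ∀ n, (∀ x, x < n → a.eval (Env.cons x ρ) ≠ 0) → R n (S 0) b ≠ 0 := by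
    intro n h
    -- The bound n is kept fixed and k runs up to it, so the induction formula contains no bounded
    -- quantifier.
    refine ind (fun k => k ≤ n → ¬ R k (S 0) b = 0) (fun _ => by simp)
      (fun k ih hk => ?_) n le_rfl
    have hk' := (S_le k n).1 hk
    rw [hb']
    exact not_or.2 ⟨h k hk', ih hk'.le⟩
  rw [bexT, eval_recur]
  refine ⟨fun h => ?_, fun ⟨x, hx, h⟩ => h₁ x _ h hx⟩
  by_contra! hc
  exact h₂ _ hc h

theorem eval_exT {φ : Tm Γ (Ty.one ⇒ Ty.nat)} (hφ : IsE2 (φ.eval ρ))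
    (a : Tm (Ty.nat :: Γ) Ty.nat) :
    (exT φ a).eval ρ = 0 ↔ ∃ x, a.eval (Env.cons x ρ) = 0 := by
  rw [exT, Tm.eval_app, ← hφ]; simp

theorem eval_allT {φ : Tm Γ (Ty.one ⇒ Ty.nat)} (hφ : IsE2 (φ.eval ρ))
    (a : Tm (Ty.nat :: Γ) Ty.nat) :
    (allT φ a).eval ρ = 0 ↔ ∀ x, a.eval (Env.cons x ρ) = 0 := by
  rw [allT, eval_notT, eval_exT ρ hφ]; simp [eval_notT]

end Eval

/-! ## Binary strings in a model -/

def half (n : M.N) : M.N := R n 0 ((lam (lam (monus v0 v1))).eval (Env.nil M))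

def par (s : M.N) : M.N := half (P s)

def anc (s j : M.N) : M.N := R j s ((lam (lam (parT v1))).eval (Env.nil M))

def sn (s b : M.N) : M.N := S (s + s + b)

/-- The string `f 0, …, f (k - 1)`. -/
def iseg (f : M.D Ty.one) (k : M.N) : M.N :=
  R k 0 ((lam (lam (snoc v1 (v2 ⬝ v0)))).eval (Env.cons f (Env.nil M)))

section Eval

variable {Γ : List Ty} (ρ : Env M Γ)

@[simp] theorem eval_halfT (n : Tm Γ Ty.nat) : (halfT n).eval ρ = half (n.eval ρ) := by
  refine congrArg (R (n.eval ρ) 0) (Str.ext fun x => Str.ext fun y => ?_)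
  simp

@[simp] theorem eval_parT (n : Tm Γ Ty.nat) : (parT n).eval ρ = par (n.eval ρ) := by
  simp [parT, par]

@[simp] theorem eval_ancT (s j : Tm Γ Ty.nat) :
    (ancT s j).eval ρ = anc (s.eval ρ) (j.eval ρ) := by
  refine congrArg (R (j.eval ρ) (s.eval ρ)) (Str.ext fun x => Str.ext fun y => ?_)
  simp

@[simp] theorem eval_snoc (s b : Tm Γ Ty.nat) : (snoc s b).eval ρ = sn (s.eval ρ) (b.eval ρ) := by
  simp [snoc, sn]

@[simp] theorem eval_initSeg (f : Tm Γ Ty.one) (k : Tm Γ Ty.nat) :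
    (initSeg f k).eval ρ = iseg (f.eval ρ) (k.eval ρ) := by
  refine congrArg (R (k.eval ρ) 0) (Str.ext fun x => Str.ext fun y => ?_)
  simp

end Eval

section

variable {σ : Ty} (F G : M.D σ → M.N) [Rep F] [Rep G]

instance rep_half : Rep (fun x => half (F x)) := inferInstanceAs (Rep (fun x => Str.R (F x) 0 _))

instance rep_half_eta : Rep (half : M.N → M.N) := rep_half (fun x => x)

instance rep_par : Rep (fun x => par (F x)) := inferInstanceAs (Rep (fun x => half (P (F x))))

instance rep_anc : Rep (fun x => anc (F x) (G x)) :=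
  inferInstanceAs (Rep (fun x => Str.R (G x) (F x) _))

instance rep_anc_eta (s : M.N) : Rep (anc s) := rep_anc (fun _ => s) (fun x => x)

instance rep_iseg (f : M.D Ty.one) : Rep (fun x => iseg f (F x)) :=
  inferInstanceAs (Rep (fun x => Str.R (F x) 0 _))

instance rep_iseg_eta (f : M.D Ty.one) : Rep (iseg f) := rep_iseg (fun x => x) f

end

@[simp] theorem half_zero : half (0 : M.N) = 0 := R_zero _ _

theorem half_S (n : M.N) : half (S n) = n - half n := by
  refine (R_succ _ _ _).trans ?_
  simp; rfl

theorem half_add_self (n : M.N) : half (n + n) = n :=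
  ind_eq (fun n => half (n + n)) (fun n => n) (by simp)
    (fun n h => by
      rw [add_S, S_add, half_S, half_S, h, add_sub_left, ← add_S, add_sub_left]) n

theorem half_S_add_self (n : M.N) : half (S (n + n)) = n := by
  rw [half_S, half_add_self, add_sub_left]

theorem eq_half (n : M.N) : n = half n + half n ∨ n = S (half n + half n) := by
  refine ind (fun n => n = half n + half n ∨ n = S (half n + half n)) (by simp)
    (fun n h => ?_) n
  generalize hk : half n = k at h
  rcases h with rfl | rfl
  · right; rw [half_S_add_self]
  · left; rw [half_S, hk, ← add_S, add_sub_left, S_add]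

theorem half_le (n : M.N) : half n ≤ n := by
  rcases eq_half n with h | h
  · exact (le_add_right' _ _).trans_eq h.symm
  · exact ((le_add_right' _ _).trans (lt_S_self _).le).trans_eq h.symm

@[simp] theorem par_zero : par (0 : M.N) = 0 := by simp [par]

theorem sn_ne_zero (s b : M.N) : sn s b ≠ 0 := S_ne_zero _

theorem par_sn (s : M.N) {b : M.N} (hb : b ≤ S 0) : par (sn s b) = s := by
  rw [par, sn, P_S]
  rcases (le_one_iff b).1 hb with rfl | rfl
  · rw [add_zero', half_add_self]
  · rw [add_S, add_zero', half_S_add_self]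

theorem sn_inj {s t b c : M.N} (hb : b ≤ S 0) (hc : c ≤ S 0) (h : sn s b = sn t c) :
    s = t ∧ b = c := by
  have hs : s = t := by rw [← par_sn s hb, h, par_sn t hc]
  subst hs
  refine ⟨rfl, ?_⟩
  have := congrArg (fun x => P x - (s + s)) h
  simpa [sn] using this

theorem exists_eq_sn {s : M.N} (h : s ≠ 0) : ∃ b, b ≤ S 0 ∧ s = sn (par s) b := by
  obtain ⟨n, rfl⟩ := (eq_zero_or_S s).resolve_left h
  rw [par, P_S]
  rcases eq_half n with h | h
  · exact ⟨0, zero_le' _, by rw [sn, add_zero', ← h]⟩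
  · exact ⟨S 0, le_rfl, by rw [sn, add_S, add_zero', ← h]⟩

theorem par_le (s : M.N) : par s ≤ P s := half_le _

theorem lt_sn (s b : M.N) : s < sn s b := by
  rw [sn, lt_S, add_assoc']; exact le_add_right' _ _

@[simp] theorem anc_zero (s : M.N) : anc s 0 = s := R_zero _ _

@[simp] theorem anc_S (s j : M.N) : anc s (S j) = par (anc s j) := by
  refine (R_succ _ _ _).trans ?_
  simp; rfl

theorem anc_par (s j : M.N) : anc (par s) j = par (anc s j) :=
  ind_eq (fun j => anc (par s) j) (fun j => par (anc s j)) (by simp) (fun n h => by simp [h]) j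

@[simp] theorem iseg_zero (f : M.D Ty.one) : iseg f 0 = 0 := R_zero _ _

@[simp] theorem iseg_S (f : M.D Ty.one) (k : M.N) : iseg f (S k) = sn (iseg f k) (M.app f k) := by
  refine (R_succ _ _ _).trans ?_
  simp; rfl


/-! ## The principles in a model -/

def IsSet (X : M.D Ty.one) : Prop := ∀ n, M.app X n ≤ S 0

/-- Membership in a set of numbers. -/
def Mem (n : M.N) (X : M.D Ty.one) : Prop := M.app X n = S 0

def IsInf (X : M.D Ty.one) : Prop := ∀ k, ∃ n, k < n ∧ Mem n X

def IsCol (c : M.D Ty.col) : Prop := ∀ x y, x < y → M.app (M.app c x) y ≤ S 0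

def HomOf (c : M.D Ty.col) (X : M.D Ty.one) (i : M.N) : Prop :=
  ∀ x y, x < y → Mem x X → Mem y X → M.app (M.app c x) y = i

def IsURT (Ψ : M.D (Ty.col ⇒ Ty.one)) : Prop :=
  ∀ c, IsCol c → IsSet (M.app Ψ c) ∧ IsInf (M.app Ψ c) ∧
    (HomOf c (M.app Ψ c) 0 ∨ HomOf c (M.app Ψ c) (S 0))

def IsWitness (Ψ : M.D (Ty.col ⇒ Ty.one)) (Ξ : M.D (Ty.col ⇒ Ty.nat ⇒ Ty.nat)) : Prop :=
  ∀ c, IsCol c → ∀ k, k < M.app (M.app Ξ c) k ∧ Mem (M.app (M.app Ξ c) k) (M.app Ψ c)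

def IsTree (T : M.D Ty.one) : Prop :=
  IsSet T ∧ ∀ s b, b ≤ S 0 → Mem (sn s b) T → Mem s T

def IsPath (f T : M.D Ty.one) : Prop := IsSet f ∧ ∀ n, Mem (iseg f n) T

def IsUWKL (Φ : M.D (Ty.one ⇒ Ty.one)) : Prop := ∀ T, IsTree T ∧ IsInf T → IsPath (M.app Φ T) T

section Sat

variable {Γ : List Ty} (ρ : Env M Γ)

@[simp] theorem sat_le (s t : Tm Γ Ty.nat) : (le s t).Sat ρ ↔ s.eval ρ ≤ t.eval ρ := by
  simp [le, le_def]

@[simp] theorem sat_lt (s t : Tm Γ Ty.nat) : (lt s t).Sat ρ ↔ s.eval ρ < t.eval ρ := by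
  simp [lt, S_le]

omit [M.IsModel] in
@[simp] theorem sat_mem (n : Tm Γ Ty.nat) (X : Tm Γ Ty.one) :
    (mem n X).Sat ρ ↔ Mem (n.eval ρ) (X.eval ρ) := Iff.rfl

@[simp] theorem sat_isSet (X : Tm Γ Ty.one) : (isSet X).Sat ρ ↔ IsSet (X.eval ρ) := by
  simp [isSet, IsSet]

@[simp] theorem sat_infinite (X : Tm Γ Ty.one) : (infinite X).Sat ρ ↔ IsInf (X.eval ρ) := by
  simp [infinite, IsInf]

@[simp] theorem sat_colouring (c : Tm Γ Ty.col) : (colouring c).Sat ρ ↔ IsCol (c.eval ρ) := by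
  simp [colouring, IsCol]

@[simp] theorem sat_homogeneousOf (c : Tm Γ Ty.col) (X : Tm Γ Ty.one) (i : Tm Γ Ty.nat) :
    (homogeneousOf c X i).Sat ρ ↔ HomOf (c.eval ρ) (X.eval ρ) (i.eval ρ) := by
  simp [homogeneousOf, HomOf]

@[simp] theorem sat_URTfor (Ψ : Tm Γ (Ty.col ⇒ Ty.one)) :
    (URTfor Ψ).Sat ρ ↔ IsURT (Ψ.eval ρ) := by
  simp [URTfor, IsURT, homogeneous]

@[simp] theorem sat_infinitudeWitness (Ψ : Tm Γ (Ty.col ⇒ Ty.one))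
    (Ξ : Tm Γ (Ty.col ⇒ Ty.nat ⇒ Ty.nat)) :
    (infinitudeWitness Ψ Ξ).Sat ρ ↔ IsWitness (Ψ.eval ρ) (Ξ.eval ρ) := by
  simp [infinitudeWitness, IsWitness]

@[simp] theorem sat_UWKLfor (Φ : Tm Γ (Ty.one ⇒ Ty.one)) :
    (UWKLfor Φ).Sat ρ ↔ IsUWKL (Φ.eval ρ) := by
  simp [UWKLfor, IsUWKL, tree, IsTree, path, IsPath]

@[simp] theorem sat_URT : URT.Sat (Env.nil M) ↔ ∃ Ψ : M.D (Ty.col ⇒ Ty.one), IsURT Ψ := by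
  simp [URT]

@[simp] theorem sat_UWKL : UWKL.Sat (Env.nil M) ↔ ∃ Φ : M.D (Ty.one ⇒ Ty.one), IsUWKL Φ := by
  simp [UWKL]

omit [M.IsModel] in
@[simp] theorem sat_E2 : E2.Sat (Env.nil M) ↔ ∃ φ : M.D (Ty.one ⇒ Ty.nat), IsE2 φ := by
  simp [E2, IsE2]

end Sat

/-! ### Characteristic functions -/

/-- `1` if `a` is true, and `0` otherwise. -/
def chiT {Γ : List Ty} (a : Tm Γ Ty.nat) : Tm Γ Ty.nat := condT a one zero

theorem eval_chiT {Γ : List Ty} (ρ : Env M Γ) (a : Tm Γ Ty.nat) :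
    (chiT a).eval ρ = S 0 ↔ a.eval ρ = 0 := by
  simp [chiT]

theorem eval_chiT_le {Γ : List Ty} (ρ : Env M Γ) (a : Tm Γ Ty.nat) :
    (chiT a).eval ρ ≤ S 0 := by
  rw [chiT, eval_condT]; split_ifs
  exacts [le_rfl, zero_le' _]

theorem eval_chiT_of_not {Γ : List Ty} (ρ : Env M Γ) {a : Tm Γ Ty.nat} (h : a.eval ρ ≠ 0) :
    (chiT a).eval ρ = 0 := by
  simp [chiT, h]

/-- Sets with the same members are the same object, so every functional takes the same value at
them; Grilliot's argument for trees rests on this. -/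
theorem isSet_eq {X Y : M.D Ty.one} (hX : IsSet X) (hY : IsSet Y) (h : ∀ n, Mem n X ↔ Mem n Y) :
    X = Y := by
  refine Str.ext fun n => ?_
  have := h n
  unfold Mem at this
  rcases (le_one_iff _).1 (hX n) with h₁ | h₁ <;> rcases (le_one_iff _).1 (hY n) with h₂ | h₂ <;>
    simp_all

theorem le_iseg (f : M.D Ty.one) (n : M.N) : n ≤ iseg f n :=
  ind (fun n => n ≤ iseg f n) (zero_le' _)
    (fun n h => by rw [iseg_S, S_le]; exact h.trans_lt (lt_sn _ _)) n

theorem par_iseg {f : M.D Ty.one} (hf : IsSet f) (n : M.N) : par (iseg f n) = iseg f (P n) := by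
  rcases eq_zero_or_S n with rfl | ⟨m, rfl⟩
  · simp
  · rw [iseg_S, par_sn _ (hf m), P_S]

theorem anc_iseg {f : M.D Ty.one} (hf : IsSet f) (n j : M.N) :
    anc (iseg f n) j = iseg f (n - j) :=
  ind_eq (fun j => anc (iseg f n) j) (fun j => iseg f (n - j)) (by simp)
    (fun j h => by rw [anc_S, h, par_iseg hf, sub_S]) j

/-- `s` extends the string `σ`. -/
def Ext (σ s : M.N) : Prop := ∃ j, j < S s ∧ anc s j = σ

@[simp] theorem eval_extT {Γ : List Ty} (ρ : Env M Γ) (σ s : Tm Γ Ty.nat) :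
    (extT σ s).eval ρ = 0 ↔ Ext (σ.eval ρ) (s.eval ρ) := by
  simp [extT, eval_bexT, eval_eqT, Ext]

theorem Ext.of_par {σ s : M.N} (h : Ext σ (par s)) : Ext σ s := by
  rcases eq_zero_or_S s with rfl | ⟨n, rfl⟩
  · simpa using h
  · obtain ⟨j, hj, h⟩ := h
    refine ⟨S j, ?_, by rw [anc_S, ← anc_par, h]⟩
    have := par_le (S n)
    rw [P_S] at this
    rw [← S_le, le_def, S_sub_S, ← le_def, S_le]
    exact (lt_S _ _).2 (((lt_S _ _).1 hj).trans this)

theorem ext_iseg {f : M.D Ty.one} (hf : IsSet f) {m n : M.N} (h : m ≤ n) :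
    Ext (iseg f m) (iseg f n) := by
  obtain ⟨d, rfl⟩ := (le_iff_exists m n).1 h
  refine ⟨d, (lt_S _ _).2 (le_trans ?_ (le_iseg f _)), ?_⟩
  · rw [add_comm']; exact le_add_right' _ _
  · rw [anc_iseg hf, add_comm', add_sub_left]


/-! ## From uniform weak König's lemma to `(∃²)` -/

section Terms

variable {Γ : List Ty}

/-- The tree of the strings that do not extend the string with the single bit `b`, or whose code
lies below the first zero of `g`. -/
def cutTreeT (b : Tm Γ Ty.nat) (g : Tm Γ Ty.one) : Tm Γ Ty.one :=
  lam (chiT (impT (extT (succ b.wk) v0) (notT (bexT (succ v0) (g.wk.wk ⬝ v0)))))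

/-- The first bit of the path `Φ` chooses through the full tree. -/
def firstBitT (Φ : Tm Γ (Ty.one ⇒ Ty.one)) : Tm Γ Ty.nat := Φ ⬝ lam one ⬝ zero

/-- A functional as in `(∃²)`, from a functional `Φ` for uniform weak König's lemma. -/
def e2OfUWKL (Φ : Tm Γ (Ty.one ⇒ Ty.one)) : Tm Γ (Ty.one ⇒ Ty.nat) :=
  lam (notT (eqT (Φ.wk ⬝ cutTreeT (firstBitT Φ).wk v0 ⬝ zero) (firstBitT Φ).wk))

end Terms

section

variable {Γ : List Ty} (ρ : Env M Γ)

theorem mem_cutTreeT (b : Tm Γ Ty.nat) (g : Tm Γ Ty.one) (s : M.N) :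
    Mem s ((cutTreeT b g).eval ρ) ↔
      (Ext (S (b.eval ρ)) s → ∀ x, x ≤ s → M.app (g.eval ρ) x ≠ 0) := by
  simp [Mem, cutTreeT, eval_chiT, eval_impT, eval_notT, eval_bexT, lt_S]

theorem isTree_cutTreeT (b : Tm Γ Ty.nat) (g : Tm Γ Ty.one) : IsTree ((cutTreeT b g).eval ρ) := by
  refine ⟨fun n => ?_, fun s i hi h => ?_⟩
  · rw [cutTreeT, Tm.eval_lam]; exact eval_chiT_le _ _
  · rw [mem_cutTreeT] at h ⊢
    exact fun hs x hx => h (.of_par (by rwa [par_sn s hi])) x (hx.trans (lt_sn s i).le)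

/-- This explains the `succ` in `cutTreeT`: the string with the single bit b has the code b + 1. -/
theorem sn_zero_zero (b : M.N) : sn 0 b = S b := by rw [sn, add_zero', zero_add']

/-- The element with constant value `b`. -/
def constSeq (b : M.N) : M.D Ty.one := M.app (M.con (Con.K _ _)) b

@[simp] theorem app_constSeq (b n : M.N) : M.app (constSeq b) n = b := Str.IsModel.K _ _

/-- Only strings starting with b are ever cut off, so all the strings c, cc, ccc, … for the other
bit c survive. -/
theorem isInf_cutTreeT (b : Tm Γ Ty.nat) (g : Tm Γ Ty.one) (hb : b.eval ρ ≤ S 0) :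
    IsInf ((cutTreeT b g).eval ρ) := by
  obtain ⟨c, hc, hne⟩ : ∃ c : M.N, c ≤ S 0 ∧ c ≠ b.eval ρ := by
    rcases (le_one_iff _).1 hb with h | h
    · exact ⟨S 0, le_rfl, by simp [h]⟩
    · exact ⟨0, zero_le' _, by simp [h]⟩
  have hs : IsSet (constSeq c) := fun n => by simpa using hc
  intro k
  refine ⟨iseg (constSeq c) (S k), (S_le _ _).1 (le_iseg _ _), ?_⟩
  rw [mem_cutTreeT]
  rintro ⟨j, -, hj⟩
  exfalso
  rw [anc_iseg hs, ← sn_zero_zero (b.eval ρ)] at hj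
  rcases eq_zero_or_S (S k - j) with h | ⟨d, h⟩
  · rw [h, iseg_zero] at hj
    exact sn_ne_zero _ _ hj.symm
  · rw [h, iseg_S, app_constSeq] at hj
    exact hne (sn_inj hc hb hj).2

theorem isUWKL_full {Φ : M.D (Ty.one ⇒ Ty.one)} (hΦ : IsUWKL Φ) {T : M.D Ty.one}
    (hT : ∀ s, M.app T s = S 0) : IsPath (M.app Φ T) T := by
  refine hΦ T ⟨⟨fun s => (hT s).le, fun s _ _ _ => hT s⟩, fun k => ⟨S k, lt_S_self k, hT _⟩⟩

theorem isE2_e2OfUWKL {Φ : Tm Γ (Ty.one ⇒ Ty.one)} (hΦ : IsUWKL (Φ.eval ρ)) :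
    IsE2 ((e2OfUWKL Φ).eval ρ) := by
  intro g
  have hb : (firstBitT Φ).eval ρ ≤ S 0 := (isUWKL_full hΦ (fun s => by simp)).1 0
  set ρ' := Env.cons g ρ with hρ'
  have hb' : (firstBitT Φ).wk.eval ρ' = (firstBitT Φ).eval ρ := Tm.eval_wk _ _ _
  have hT := isTree_cutTreeT ρ' (firstBitT Φ).wk v0
  have hI := isInf_cutTreeT ρ' (firstBitT Φ).wk v0 (by rwa [hb'])
  have hm := mem_cutTreeT ρ' (firstBitT Φ).wk v0
  have hp := hΦ _ ⟨hT, hI⟩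
  have hg : (v0 : Tm (Ty.one :: Γ) Ty.one).eval ρ' = g := rfl
  have e : M.app ((e2OfUWKL Φ).eval ρ) g = 0 ↔
      M.app (M.app (Φ.eval ρ) ((cutTreeT (firstBitT Φ).wk v0).eval ρ')) 0 ≠
        (firstBitT Φ).eval ρ := by
    rw [e2OfUWKL, Tm.eval_lam, eval_notT, eval_eqT]
    simp [hρ']
  rw [e]
  constructor
  · rintro ⟨z, hz⟩ h0
    -- If the path began with b, its segment of length z + 1 would extend ⟨b⟩; its code is at least
    -- z + 1, so the zero z has already cut it off.
    have h := hp.2 (S z)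
    rw [hm] at h
    have hx := ext_iseg hp.1 ((S_le 0 (S z)).2 ((lt_S _ _).2 (zero_le' z)))
    rw [iseg_S, iseg_zero, sn_zero_zero, h0, ← hb'] at hx
    exact h hx z ((lt_S_self z).le.trans (le_iseg _ _)) (by rw [hg]; exact hz)
  · intro h0
    by_contra! hz
    apply h0
    -- Without a zero nothing is cut off, and the tree is the full tree that defined b.
    have : (cutTreeT (firstBitT Φ).wk v0).eval ρ' = (lam one).eval ρ := by
      refine isSet_eq hT.1 (fun n => by simp) (fun n => ?_)
      rw [hm, hg]
      simp [Mem, hz]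
    rw [this]; rfl

end

/-! ## From uniform Ramsey's theorem to `(∃²)` -/

section Terms

variable {Γ : List Ty}

/-- The colouring with `{x, y}` of colour `1` if `y > b` and `g` has a zero below `y`. -/
def jumpColT (b : Tm Γ Ty.nat) (g : Tm Γ Ty.one) : Tm Γ Ty.col :=
  lam (lam (chiT (add (ltT b.wk.wk v0) (bexT v0 (g.wk.wk.wk ⬝ v0)))))

/-- The colouring with the one colour `0`. -/
def zeroCol : Tm Γ Ty.col := lam (lam zero)

/-- A functional as in `(∃²)`, from a functional `Ψ` for uniform Ramsey's theorem and two elements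
`a < b` of its value at `zeroCol`. -/
def e2OfURT (Ψ : Tm Γ (Ty.col ⇒ Ty.one)) (a b : Tm Γ Ty.nat) : Tm Γ (Ty.one ⇒ Ty.nat) :=
  lam (notT (add (eqT (Ψ.wk ⬝ jumpColT b.wk v0 ⬝ a.wk) one)
    (eqT (Ψ.wk ⬝ jumpColT b.wk v0 ⬝ b.wk) one)))

end Terms

section

variable {Γ : List Ty} (ρ : Env M Γ)

theorem jumpColT_eq_one (b : Tm Γ Ty.nat) (g : Tm Γ Ty.one) (x y : M.N) :
    M.app (M.app ((jumpColT b g).eval ρ) x) y = S 0 ↔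
      b.eval ρ < y ∧ ∃ z, z < y ∧ M.app (g.eval ρ) z = 0 := by
  rw [jumpColT, Tm.eval_lam, Tm.eval_lam, eval_chiT, eval_add_eq_zero, eval_ltT, eval_bexT]
  simp

theorem isCol_jumpColT (b : Tm Γ Ty.nat) (g : Tm Γ Ty.one) : IsCol ((jumpColT b g).eval ρ) := by
  intro x y _
  rw [jumpColT, Tm.eval_lam, Tm.eval_lam]
  exact eval_chiT_le _ _

theorem isCol_zeroCol : IsCol ((zeroCol : Tm Γ Ty.col).eval ρ) := by
  intro x y _
  simpa [zeroCol] using zero_le' _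

theorem isE2_e2OfURT {Ψ : Tm Γ (Ty.col ⇒ Ty.one)} {a b : Tm Γ Ty.nat} (hΨ : IsURT (Ψ.eval ρ))
    (hab : a.eval ρ < b.eval ρ) (ha : Mem (a.eval ρ) (M.app (Ψ.eval ρ) (zeroCol.eval ρ)))
    (hb : Mem (b.eval ρ) (M.app (Ψ.eval ρ) (zeroCol.eval ρ))) :
    IsE2 ((e2OfURT Ψ a b).eval ρ) := by
  intro g
  set ρ' := Env.cons g ρ with hρ'
  set c := (jumpColT b.wk v0).eval ρ' with hc
  have hone : ∀ x y, M.app (M.app c x) y = S 0 ↔ b.eval ρ < y ∧ ∃ z, z < y ∧ M.app g z = 0 := by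
    intro x y
    rw [hc, jumpColT_eq_one, hρ', Tm.eval_wk]; rfl
  have hcol : IsCol c := isCol_jumpColT _ _ _
  obtain ⟨-, hinf, hhom⟩ := hΨ c hcol
  have e : M.app ((e2OfURT Ψ a b).eval ρ) g = 0 ↔
      ¬ (Mem (a.eval ρ) (M.app (Ψ.eval ρ) c) ∧ Mem (b.eval ρ) (M.app (Ψ.eval ρ) c)) := by
    rw [e2OfURT, Tm.eval_lam, eval_notT, eval_add_eq_zero, eval_eqT, eval_eqT]
    simp [hρ', Mem, hc]
  rw [e]
  constructor
  · rintro ⟨z, hz⟩ ⟨ha', hb'⟩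
    rcases hhom with h | h
    -- Two elements beyond both z and b form a pair of colour 1, which excludes the homogeneous
    -- colour 0.
    · obtain ⟨x, hx, hxX⟩ := hinf (max z (b.eval ρ))
      obtain ⟨y, hy, hyX⟩ := hinf x
      have h₁ := (hone x y).2 ⟨((le_max_right _ _).trans_lt hx).trans hy, z,
        ((le_max_left _ _).trans_lt hx).trans hy, hz⟩
      rw [h x y hy hxX hyX] at h₁
      exact zero_ne_S _ h₁
    -- The pair {a, b} itself would have colour 1, but this needs a larger element above b.
    · exact lt_irrefl _ ((hone _ _).1 (h _ _ hab ha' hb')).1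
  · intro h
    by_contra! hz
    apply h
    have : c = zeroCol.eval ρ := by
      refine Str.ext fun x => Str.ext fun y => ?_
      rw [zeroCol, Tm.eval_lam, Tm.eval_lam, hc, jumpColT, Tm.eval_lam, Tm.eval_lam]
      refine eval_chiT_of_not _ fun h₀ => ?_
      have := (hone x y).1 (by
        rw [hc, jumpColT, Tm.eval_lam, Tm.eval_lam]; exact (eval_chiT _ _).2 h₀)
      obtain ⟨-, z, -, h₁⟩ := this
      exact hz z h₁
    rw [this]; exact ⟨ha, hb⟩

end


/-! ## From `(∃²)` to uniform weak König's lemma -/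

section Terms

variable {Γ : List Ty}

/-- The string `σ` has infinitely many extensions in `T`. -/
def infExtT (φ : Tm Γ (Ty.one ⇒ Ty.nat)) (T : Tm Γ Ty.one) (σ : Tm Γ Ty.nat) : Tm Γ Ty.nat :=
  allT φ (exT φ.wk (add (ltT v1 v0) (add (eqT (T.wk.wk ⬝ v0) one) (extT σ.wk.wk v0))))

/-- The bit that follows the string `s` on the leftmost path. -/
def nextBitT (φ : Tm Γ (Ty.one ⇒ Ty.nat)) (T : Tm Γ Ty.one) (s : Tm Γ Ty.nat) : Tm Γ Ty.nat :=
  condT (infExtT φ T (snoc s zero)) zero one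

/-- The leftmost path through `T`. -/
def leftPathT (φ : Tm Γ (Ty.one ⇒ Ty.nat)) (T : Tm Γ Ty.one) : Tm Γ Ty.one :=
  lam (nextBitT φ.wk T.wk
    (recur v0 zero (lam (lam (snoc v1 (nextBitT φ.wk.wk.wk T.wk.wk.wk v1))))))

/-- A functional for uniform weak König's lemma, from `φ` as in `(∃²)`. -/
def uwklOfE2 (φ : Tm Γ (Ty.one ⇒ Ty.nat)) : Tm Γ (Ty.one ⇒ Ty.one) := lam (leftPathT φ.wk v0)

end Terms

/-- The string `σ` has infinitely many extensions in `T`. -/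
def InfExt (T : M.D Ty.one) (σ : M.N) : Prop := ∀ k, ∃ s, k < s ∧ Mem s T ∧ Ext σ s

theorem eval_infExtT {Γ : List Ty} (ρ : Env M Γ) {φ : Tm Γ (Ty.one ⇒ Ty.nat)}
    (hφ : IsE2 (φ.eval ρ)) (T : Tm Γ Ty.one) (σ : Tm Γ Ty.nat) :
    (infExtT φ T σ).eval ρ = 0 ↔ InfExt (T.eval ρ) (σ.eval ρ) := by
  rw [infExtT, eval_allT ρ hφ]
  refine forall_congr' fun k => ?_
  rw [eval_exT _ (by simpa using hφ)]
  refine exists_congr fun s => ?_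
  simp only [eval_add_eq_zero, eval_ltT, eval_eqT, eval_extT]
  simp [Mem]

/-- Deleting a bit lowers a nonzero code by at least one. Hence s deletions empty the string s, and
the bound on j in `Ext` loses nothing at the root. -/
theorem anc_le (s j : M.N) : anc s j ≤ s - j :=
  ind (fun j => anc s j ≤ s - j) (by simp)
    (fun j h => by
      rw [anc_S, sub_S]
      refine (par_le _).trans ?_
      rcases eq_zero_or_S (anc s j) with h' | ⟨d, h'⟩
      · rw [h', P_zero]; exact zero_le' _
      · obtain ⟨e, he⟩ : ∃ e, s - j = S e :=
          (eq_zero_or_S _).resolve_left fun h₀ => by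
            rw [h', h₀, S_le] at h; exact absurd (zero_le' d) (not_le.2 h)
        rw [h', he] at h ⊢
        rw [P_S, P_S]
        rwa [le_def, S_sub_S] at h) j

theorem ext_zero (s : M.N) : Ext 0 s :=
  ⟨s, lt_S_self s, le_antisymm (by simpa using anc_le s s) (zero_le' _)⟩

/-- Walking from s towards the root, the string met just before σ is first reached is a child of σ.
The proof is by contraposition: if no child of σ is met, neither is σ. -/
theorem Ext.step {σ s : M.N} (h : Ext σ s) (hs : σ ≠ s) : ∃ b, b ≤ S 0 ∧ Ext (sn σ b) s := by
  by_contra! hc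
  obtain ⟨j, hj, h⟩ := h
  refine ind (fun i => i < S s → ¬ anc s i = σ) (fun _ => by simpa using hs.symm)
    (fun i ih hi h' => ?_) j hj h
  have hi' : i < S s := (lt_S_self i).trans hi
  have hn := ih hi'
  rw [anc_S] at h'
  -- The root is its own parent, so there the step moves nowhere.
  by_cases h₀ : anc s i = 0
  · rw [h₀, par_zero] at h'
    exact hn (h₀.trans h')
  · obtain ⟨b, hb, e⟩ := exists_eq_sn h₀
    rw [h'] at e
    exact hc b hb ⟨i, hi', e⟩

theorem IsTree.mem_of_ext {T : M.D Ty.one} (hT : IsTree T) {σ s : M.N} (h : Ext σ s)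
    (hs : Mem s T) : Mem σ T := by
  obtain ⟨j, -, rfl⟩ := h
  refine ind (fun j => M.app T (anc s j) = S 0) (by rw [anc_zero]; exact hs)
    (fun j h => ?_) j
  rw [anc_S]
  by_cases h₀ : anc s j = 0
  · rw [h₀] at h ⊢
    rwa [par_zero]
  · obtain ⟨b, hb, e⟩ := exists_eq_sn h₀
    exact hT.2 _ b hb (by rw [← e]; exact h)

theorem InfExt.step {T : M.D Ty.one} {σ : M.N} (h : InfExt T σ) (h₀ : ¬ InfExt T (sn σ 0)) :
    InfExt T (sn σ (S 0)) := by
  unfold InfExt at h₀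
  push Not at h₀
  obtain ⟨k, hk⟩ := h₀
  intro l
  -- Beyond k no extension goes through bit 0; exceeding σ as well makes s a proper extension, so it
  -- goes through bit 1.
  obtain ⟨s, hs, hsT, hσ⟩ := h (max (max k l) σ)
  have hs₁ := (le_max_right _ _).trans_lt hs
  have hs₂ := (le_max_left _ _).trans_lt hs
  obtain ⟨b, hb, hb'⟩ := hσ.step hs₁.ne
  rcases (le_one_iff b).1 hb with rfl | rfl
  · exact absurd hb' (hk s ((le_max_left _ _).trans_lt hs₂) hsT)
  · exact ⟨s, (le_max_right _ _).trans_lt hs₂, hsT, hb'⟩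

section

variable {Γ : List Ty} (ρ : Env M Γ)

open Classical in
theorem eval_nextBitT {φ : Tm Γ (Ty.one ⇒ Ty.nat)} (hφ : IsE2 (φ.eval ρ)) (T : Tm Γ Ty.one)
    (s : Tm Γ Ty.nat) : (nextBitT φ T s).eval ρ =
      if InfExt (T.eval ρ) (sn (s.eval ρ) 0) then 0 else S 0 := by
  simp [nextBitT, eval_infExtT ρ hφ]

theorem isPath_leftPathT {φ : Tm Γ (Ty.one ⇒ Ty.nat)} (hφ : IsE2 (φ.eval ρ)) {T : Tm Γ Ty.one}
    (hT : IsTree (T.eval ρ)) (hI : IsInf (T.eval ρ)) :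
    IsPath ((leftPathT φ T).eval ρ) (T.eval ρ) := by
  classical
  set f := (leftPathT φ T).eval ρ with hf
  set b : M.D (Ty.nat ⇒ Ty.nat ⇒ Ty.nat) :=
    (lam (lam (snoc v1 (nextBitT φ.wk.wk T.wk.wk v1)))).eval ρ with hb
  have hφ₂ : ∀ x y : M.N, IsE2 (φ.wk.wk.eval (Env.cons x (Env.cons y ρ))) :=
    fun x y => by simpa using hφ
  have hr : ∀ n, R (S n) 0 b =
      sn (R n 0 b) (if InfExt (T.eval ρ) (sn (R n 0 b) 0) then 0 else S 0) := by
    intro n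
    rw [R_succ, hb, Tm.eval_lam, Tm.eval_lam, eval_snoc, eval_nextBitT _ (hφ₂ _ _)]
    simp
  have hfn : ∀ n, M.app f n = if InfExt (T.eval ρ) (sn (R n 0 b) 0) then 0 else S 0 := by
    intro n
    rw [hf, leftPathT, Tm.eval_lam, eval_nextBitT _ (by simpa using hφ), Tm.eval_wk, eval_recur]
    -- The step function under one more binder is a different term, but extensionally the same
    -- element.
    have : (lam (lam (snoc v1 (nextBitT φ.wk.wk.wk T.wk.wk.wk v1)))).eval (Env.cons n ρ) = b := by
      refine Str.ext fun x => Str.ext fun y => ?_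
      rw [hb, Tm.eval_lam, Tm.eval_lam, Tm.eval_lam, Tm.eval_lam, eval_snoc, eval_snoc,
        eval_nextBitT _ (hφ₂ _ _), eval_nextBitT _ (by simpa using hφ)]
      simp
    rw [this]; rfl
  have hseg : ∀ n, iseg f n = R n 0 b :=
    ind_eq (fun n => iseg f n) (fun n => R n 0 b) (by simp)
      (fun n h => by rw [iseg_S, hr, hfn, h])
  have hinf : ∀ n, InfExt (T.eval ρ) (R n 0 b) := by
    -- Through φ, having infinitely many extensions is the zero set of the element J, so
    -- quantifier-free induction covers it.
    set J := (lam (infExtT φ.wk T.wk v0)).eval ρ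
    have hJ : ∀ s, M.app J s = 0 ↔ InfExt (T.eval ρ) s := by
      intro s
      rw [Tm.eval_lam, eval_infExtT _ (by simpa using hφ)]
      simp
    simp only [← hJ]
    refine ind (fun n => M.app J (R n 0 b) = 0) ?_ fun n h => ?_
    · rw [R_zero, hJ]
      intro k
      obtain ⟨s, hs, hsT⟩ := hI k
      exact ⟨s, hs, hsT, ext_zero s⟩
    · rw [hJ] at h ⊢
      rw [hr]
      split_ifs with h₀
      exacts [h₀, h.step h₀]
  refine ⟨fun n => ?_, fun n => ?_⟩
  · rw [hfn]; split_ifs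
    exacts [zero_le' _, le_rfl]
  · rw [hseg]
    obtain ⟨s, -, hsT, hs⟩ := hinf n 0
    exact hT.mem_of_ext hs hsT

theorem isUWKL_uwklOfE2 {φ : Tm Γ (Ty.one ⇒ Ty.nat)} (hφ : IsE2 (φ.eval ρ)) :
    IsUWKL ((uwklOfE2 φ).eval ρ) := by
  rintro T ⟨hT, hI⟩
  rw [uwklOfE2, Tm.eval_lam]
  exact isPath_leftPathT (Env.cons T ρ) (by simpa using hφ) hT hI

end


/-! ## From `(∃²)` to uniform Ramsey's theorem -/

section Terms

variable {Γ : List Ty}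

/-- The sequence of the colours `c 0 y, c 1 y, …`, made `{0, 1}`-valued. -/
def columnT (c : Tm Γ Ty.col) (y : Tm Γ Ty.nat) : Tm Γ Ty.one :=
  lam (condT (c.wk ⬝ v0 ⬝ y.wk) zero one)

/-- The tree of the strings `c 0 y, …, c (n - 1) y` for `n ≤ y`. -/
def columnTreeT (φ : Tm Γ (Ty.one ⇒ Ty.nat)) (c : Tm Γ Ty.col) : Tm Γ Ty.one :=
  lam (chiT (exT φ.wk (exT φ.wk.wk
    (add (monus v0 v1) (eqT (initSeg (columnT c.wk.wk.wk v1) v0) v2)))))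

/-- `c x y = e x` for all `x < m`. -/
def agreeT (φ : Tm Γ (Ty.one ⇒ Ty.nat)) (c : Tm Γ Ty.col) (e : Tm Γ Ty.one)
    (m y : Tm Γ Ty.nat) : Tm Γ Ty.nat :=
  allT φ (impT (ltT v0 m.wk) (eqT (c.wk ⬝ v0 ⬝ y.wk) (e.wk ⬝ v0)))

/-- The successor of the greatest element below `n` of the prehomogeneous set. -/
def boundT (φ : Tm Γ (Ty.one ⇒ Ty.nat)) (c : Tm Γ Ty.col) (e : Tm Γ Ty.one)
    (n : Tm Γ Ty.nat) : Tm Γ Ty.nat :=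
  recur n zero (lam (lam (condT (agreeT φ.wk.wk c.wk.wk e.wk.wk v1 v0) (succ v0) v1)))

/-- `y` is in the prehomogeneous set. -/
def prehomT (φ : Tm Γ (Ty.one ⇒ Ty.nat)) (c : Tm Γ Ty.col) (e : Tm Γ Ty.one)
    (y : Tm Γ Ty.nat) : Tm Γ Ty.nat :=
  agreeT φ c e (boundT φ c e y) y

/-- The prehomogeneous set has infinitely many elements of colour `1`. -/
def infOneT (φ : Tm Γ (Ty.one ⇒ Ty.nat)) (c : Tm Γ Ty.col) (e : Tm Γ Ty.one) : Tm Γ Ty.nat :=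
  allT φ (exT φ.wk (add (ltT v1 v0)
    (add (prehomT φ.wk.wk c.wk.wk e.wk.wk v0) (eqT (e.wk.wk ⬝ v0) one))))

/-- The elements of the prehomogeneous set of a colour that occurs infinitely often. -/
def homT (φ : Tm Γ (Ty.one ⇒ Ty.nat)) (c : Tm Γ Ty.col) (e : Tm Γ Ty.one) : Tm Γ Ty.one :=
  lam (chiT (add (prehomT φ.wk c.wk e.wk v0)
    (eqT (e.wk ⬝ v0) (condT (infOneT φ c e).wk one zero))))

/-- A functional for uniform Ramsey's theorem, from `φ` as in `(∃²)`. -/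
def urtOfE2 (φ : Tm Γ (Ty.one ⇒ Ty.nat)) : Tm Γ (Ty.col ⇒ Ty.one) :=
  lam (homT φ.wk v0 (leftPathT φ.wk (columnTreeT φ.wk v0)))

end Terms

section

variable {Γ : List Ty} (ρ : Env M Γ)

theorem isSet_columnT (c : Tm Γ Ty.col) (y : Tm Γ Ty.nat) : IsSet ((columnT c y).eval ρ) := by
  intro n
  rw [columnT, Tm.eval_lam, eval_condT]; split_ifs
  exacts [zero_le' _, le_rfl]

theorem app_columnT {c : Tm Γ Ty.col} (hc : IsCol (c.eval ρ)) (y : Tm Γ Ty.nat) {x : M.N}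
    (hx : x < y.eval ρ) :
    M.app ((columnT c y).eval ρ) x = M.app (M.app (c.eval ρ) x) (y.eval ρ) := by
  rw [columnT, Tm.eval_lam, eval_condT]
  rcases (le_one_iff _).1 (hc _ _ hx) with h | h <;> simp [h]

theorem mem_columnTreeT {φ : Tm Γ (Ty.one ⇒ Ty.nat)} (hφ : IsE2 (φ.eval ρ)) (c : Tm Γ Ty.col)
    (s : M.N) : Mem s ((columnTreeT φ c).eval ρ) ↔
      ∃ y n, n ≤ y ∧ iseg ((columnT c.wk v0).eval (Env.cons y ρ)) n = s := by
  rw [Mem, columnTreeT, Tm.eval_lam, eval_chiT, eval_exT _ (by simpa using hφ)]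
  refine exists_congr fun y => ?_
  rw [eval_exT _ (by simpa using hφ)]
  refine exists_congr fun n => ?_
  rw [eval_add_eq_zero, eval_eqT, eval_initSeg, eval_monus, ← le_def]
  have : (columnT c.wk.wk.wk v1).eval (Env.cons n (Env.cons y (Env.cons s ρ))) =
      (columnT c.wk v0).eval (Env.cons y ρ) := by
    refine Str.ext fun x => ?_
    rw [columnT, columnT, Tm.eval_lam, Tm.eval_lam]
    simp
  rw [this]; rfl

theorem isTree_columnTreeT {φ : Tm Γ (Ty.one ⇒ Ty.nat)} (hφ : IsE2 (φ.eval ρ))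
    (c : Tm Γ Ty.col) : IsTree ((columnTreeT φ c).eval ρ) := by
  refine ⟨fun n => ?_, fun s b hb h => ?_⟩
  · rw [columnTreeT, Tm.eval_lam]; exact eval_chiT_le _ _
  · rw [mem_columnTreeT ρ hφ] at h ⊢
    obtain ⟨y, n, hn, h⟩ := h
    rcases eq_zero_or_S n with rfl | ⟨m, rfl⟩
    · rw [iseg_zero] at h; exact absurd h.symm (sn_ne_zero _ _)
    · rw [iseg_S] at h
      exact ⟨y, m, (lt_S_self m).le.trans hn, (sn_inj (isSet_columnT _ _ _ m) hb h).1⟩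

/-- Column k + 1 contributes a string of length k + 1, whose code exceeds k. -/
theorem isInf_columnTreeT {φ : Tm Γ (Ty.one ⇒ Ty.nat)} (hφ : IsE2 (φ.eval ρ))
    (c : Tm Γ Ty.col) : IsInf ((columnTreeT φ c).eval ρ) :=
  fun k => ⟨_, (lt_S_self k).trans_le (le_iseg _ _),
    (mem_columnTreeT ρ hφ c _).2 ⟨S k, S k, le_rfl, rfl⟩⟩

theorem lt_iff_sub_ne_zero (x y : M.N) : x < y ↔ y - x ≠ 0 := by
  rw [Ne, ← le_def, not_le]

/-- A string determines its length and its bits. -/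
theorem iseg_inj {f g : M.D Ty.one} (hf : IsSet f) (hg : IsSet g) {m n : M.N}
    (h : iseg f m = iseg g n) : m = n ∧ ∀ i, i < n → M.app f i = M.app g i := by
  have key : ∀ {f g : M.D Ty.one} {m n : M.N}, IsSet f → IsSet g → iseg f m = iseg g n →
      n ≤ m := by
    intro f g m n hf hg h
    by_contra! hlt
    obtain ⟨d, hd⟩ := (eq_zero_or_S (n - m)).resolve_left ((lt_iff_sub_ne_zero m n).1 hlt)
    -- Deleting m bits empties one side, but leaves at least one bit on the other.
    have h' := congrArg (fun s => anc s m) h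
    simp only [anc_iseg hf, anc_iseg hg, sub_self', hd, iseg_zero, iseg_S] at h'
    exact sn_ne_zero _ _ h'.symm
  have e := le_antisymm (key hg hf h.symm) (key hf hg h)
  subst e
  refine ⟨rfl, fun i hi => ?_⟩
  obtain ⟨d, hd⟩ := (le_iff_exists (S i) m).1 ((S_le _ _).2 hi)
  -- Deleting all but the first i + 1 bits exposes bit i as the last one.
  have h' := congrArg (fun s => anc s d) h
  simp only [anc_iseg hf, anc_iseg hg] at h'
  rw [hd, add_comm', add_sub_left, iseg_S, iseg_S] at h'
  exact (sn_inj (hf i) (hg i) h').2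

/-- A path through the tree of columns is a sequence of possible limit colours. -/
theorem exists_column_agree {φ : Tm Γ (Ty.one ⇒ Ty.nat)} (hφ : IsE2 (φ.eval ρ))
    {c : Tm Γ Ty.col} (hc : IsCol (c.eval ρ)) {e : M.D Ty.one}
    (he : IsPath e ((columnTreeT φ c).eval ρ)) (n : M.N) :
    ∃ y, n ≤ y ∧ ∀ x, x < n → M.app (M.app (c.eval ρ) x) y = M.app e x := by
  obtain ⟨y, m, hm, h⟩ := (mem_columnTreeT ρ hφ c _).1 (he.2 n)
  obtain ⟨rfl, h⟩ := iseg_inj (isSet_columnT _ _ _) he.1 h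
  refine ⟨y, hm, fun x hx => ?_⟩
  rw [← h x hx, app_columnT _ (by simpa using hc) _ (by simpa using hx.trans_le hm)]
  simp

theorem eval_agreeT {φ : Tm Γ (Ty.one ⇒ Ty.nat)} (hφ : IsE2 (φ.eval ρ)) (c : Tm Γ Ty.col)
    (e : Tm Γ Ty.one) (m y : Tm Γ Ty.nat) : (agreeT φ c e m y).eval ρ = 0 ↔
      ∀ x, x < m.eval ρ → M.app (M.app (c.eval ρ) x) (y.eval ρ) = M.app (e.eval ρ) x := by
  rw [agreeT, eval_allT ρ hφ]
  simp [eval_impT, eval_ltT, eval_eqT]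

end

/-! ### The prehomogeneous set -/

/-- `m n` is the successor of the greatest element below `n` of the set of the `y` with
`c x y = e x` for all `x < m y`. -/
structure IsBound (c : M.D Ty.col) (e : M.D Ty.one) (m : M.N → M.N) : Prop where
  rep : Rep m
  zero : m 0 = 0
  pos : ∀ y, (∀ x, x < m y → M.app (M.app c x) y = M.app e x) → m (S y) = S y
  neg : ∀ y, ¬ (∀ x, x < m y → M.app (M.app c x) y = M.app e x) → m (S y) = m y

/-- The prehomogeneous set. -/
def Prehom (c : M.D Ty.col) (e : M.D Ty.one) (m : M.N → M.N) (y : M.N) : Prop :=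
  ∀ x, x < m y → M.app (M.app c x) y = M.app e x

namespace IsBound

variable {c : M.D Ty.col} {e : M.D Ty.one} {m : M.N → M.N}

theorem le_self (h : IsBound c e m) (n : M.N) : m n ≤ n := by
  have := h.rep
  refine ind (fun n => m n ≤ n) (h.zero.le.trans (zero_le' _)) (fun n ih => ?_) n
  by_cases hn : Prehom c e m n
  · exact (h.pos n hn).le
  · exact (h.neg n hn).le.trans (ih.trans (lt_S_self n).le)

/-- The bound jumps past every member and never falls back. So agreement below the bound covers all
earlier members, and one number is enough to remember them: recursion of type 0 suffices. -/
theorem lt_of_lt (h : IsBound c e m) {x : M.N} (hx : Prehom c e m x) (n : M.N) :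
    x < n → x < m n := by
  have := h.rep
  refine ind (fun n => x < n → x < m n) (fun h₀ => absurd (zero_le' x) (not_le.2 h₀))
    (fun n ih hn => ?_) n
  by_cases hp : Prehom c e m n
  · rwa [h.pos n hp]
  · rw [h.neg n hp]
    rcases ((lt_S x n).1 hn).eq_or_lt with rfl | hlt
    · exact absurd hx hp
    · exact ih hlt

theorem apply_eq (h : IsBound c e m) {x y : M.N} (hxy : x < y) (hx : Prehom c e m x)
    (hy : Prehom c e m y) : M.app (M.app c x) y = M.app e x :=
  hy x (h.lt_of_lt hx y hxy)

/-- If there were no members beyond k, the bound would stay at m (k + 1) ≤ k + 1, and any column y >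
k agreeing with e below k + 1 would be a member after all. -/
theorem infinite (h : IsBound c e m)
    (he : ∀ n, ∃ y, n ≤ y ∧ ∀ x, x < n → M.app (M.app c x) y = M.app e x) (k : M.N) :
    ∃ y, k < y ∧ Prehom c e m y := by
  by_contra! hc
  have := h.rep
  have hm : ∀ n, k < n → m n = m (S k) := by
    refine ind (fun n => k < n → m n = m (S k)) (fun h₀ => absurd (zero_le' k) (not_le.2 h₀))
      fun n ih hn => ?_
    rcases ((lt_S k n).1 hn).eq_or_lt with rfl | hlt
    · rfl
    · rw [h.neg n (hc n hlt), ih hlt]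
  obtain ⟨y, hy, hxy⟩ := he (S k)
  have hky := (S_le k y).1 hy
  refine hc y hky fun x hx => hxy x ?_
  rw [hm y hky] at hx
  exact hx.trans_le (h.le_self _)

end IsBound

section

variable {Γ : List Ty} (ρ : Env M Γ)

/-- The step only tests the truth of the agreement, which by (∃²) depends on the values of c and e
alone. This allows the same recursion to be compared under different binders. -/
theorem boundT_step_congr {Δ : List Ty} (ρ : Env M Γ) (η : Env M Δ)
    {φ : Tm Γ (Ty.one ⇒ Ty.nat)} {ψ : Tm Δ (Ty.one ⇒ Ty.nat)} {c : Tm Γ Ty.col} {d : Tm Δ Ty.col}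
    {e : Tm Γ Ty.one} {f : Tm Δ Ty.one} (hφ : IsE2 (φ.eval ρ)) (h : φ.eval ρ = ψ.eval η)
    (hc : c.eval ρ = d.eval η) (he : e.eval ρ = f.eval η) :
    (lam (lam (condT (agreeT φ.wk.wk c.wk.wk e.wk.wk v1 v0) (succ v0) v1))).eval ρ =
      (lam (lam (condT (agreeT ψ.wk.wk d.wk.wk f.wk.wk v1 v0) (succ v0) v1))).eval η := by
  refine Str.ext fun x => Str.ext fun y => ?_
  classical
  rw [Tm.eval_lam, Tm.eval_lam, Tm.eval_lam, Tm.eval_lam, eval_condT, eval_condT]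
  refine if_congr ?_ rfl rfl
  rw [eval_agreeT _ (by simpa using hφ), eval_agreeT _ (by simpa [← h] using hφ)]
  simp [hc, he]

theorem isBound_boundT {φ : Tm Γ (Ty.one ⇒ Ty.nat)} (hφ : IsE2 (φ.eval ρ)) (c : Tm Γ Ty.col)
    (e : Tm Γ Ty.one) : IsBound (c.eval ρ) (e.eval ρ)
      (fun n => (boundT φ.wk c.wk e.wk v0).eval (Env.cons n ρ)) := by
  set b : M.D (Ty.nat ⇒ Ty.nat ⇒ Ty.nat) :=
    (lam (lam (condT (agreeT φ.wk.wk c.wk.wk e.wk.wk v1 v0) (succ v0) v1))).eval ρ with hb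
  have hφ₂ : ∀ x y : M.N, IsE2 (φ.wk.wk.eval (Env.cons x (Env.cons y ρ))) :=
    fun x y => by simpa using hφ
  have hm : (fun n => (boundT φ.wk c.wk e.wk v0).eval (Env.cons n ρ)) = fun n => R n 0 b :=
    funext fun n => congrArg (R n 0)
      (boundT_step_congr _ _ (by simpa using hφ) (by simp) (by simp) (by simp))
  have hs : ∀ n a, M.app (M.app b a) n = S n ∧
      (∀ x, x < a → M.app (M.app (c.eval ρ) x) n = M.app (e.eval ρ) x) ∨
      M.app (M.app b a) n = a ∧
      ¬ (∀ x, x < a → M.app (M.app (c.eval ρ) x) n = M.app (e.eval ρ) x) := by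
    intro n a
    have h := eval_agreeT (Env.cons n (Env.cons a ρ)) (hφ₂ n a) c.wk.wk e.wk.wk v1 v0
    simp only [Tm.eval_wk, Tm.eval_var, Env.cons_z, Env.cons_s] at h
    rw [hb, Tm.eval_lam, Tm.eval_lam, eval_condT, ← h]
    split_ifs with h₀
    · exact .inl ⟨rfl, h₀⟩
    · exact .inr ⟨rfl, h₀⟩
  rw [hm]
  refine ⟨inferInstance, R_zero _ _, fun y h => ?_, fun y h => ?_⟩
  · rw [R_succ]
    exact (hs y (R y 0 b)).elim (fun h' => h'.1) fun h' => absurd h h'.2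
  · rw [R_succ]
    exact (hs y (R y 0 b)).elim (fun h' => absurd h'.2 h) fun h' => h'.1

/-- Two contexts are allowed because `prehomT` occurs under different numbers of binders in `homT`
and `infOneT`. -/
theorem eval_prehomT {Δ : List Ty} (η : Env M Δ) {φ : Tm Γ (Ty.one ⇒ Ty.nat)}
    {ψ : Tm Δ (Ty.one ⇒ Ty.nat)} {c : Tm Γ Ty.col} {d : Tm Δ Ty.col} {e : Tm Γ Ty.one}
    {f : Tm Δ Ty.one} (hφ : IsE2 (φ.eval ρ)) (h : φ.eval ρ = ψ.eval η)
    (hc : c.eval ρ = d.eval η) (he : e.eval ρ = f.eval η) (y : Tm Δ Ty.nat) :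
    (prehomT ψ d f y).eval η = 0 ↔ Prehom (c.eval ρ) (e.eval ρ)
      (fun n => (boundT φ.wk c.wk e.wk v0).eval (Env.cons n ρ)) (y.eval η) := by
  rw [prehomT, eval_agreeT η (h ▸ hφ), Prehom, hc, he]
  have : (boundT φ.wk c.wk e.wk v0).eval (Env.cons (y.eval η) ρ) = (boundT ψ d f y).eval η :=
    congrArg (R (y.eval η) 0)
      (boundT_step_congr _ _ (by simpa using hφ) (by simpa using h) (by simpa using hc)
        (by simpa using he))
  rw [this]

theorem mem_homT {φ : Tm Γ (Ty.one ⇒ Ty.nat)} (hφ : IsE2 (φ.eval ρ)) (c : Tm Γ Ty.col)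
    (e : Tm Γ Ty.one) (y : M.N) : Mem y ((homT φ c e).eval ρ) ↔
      Prehom (c.eval ρ) (e.eval ρ)
        (fun n => (boundT φ.wk c.wk e.wk v0).eval (Env.cons n ρ)) y ∧
      M.app (e.eval ρ) y = (condT (infOneT φ c e) one zero).eval ρ := by
  rw [Mem, homT, Tm.eval_lam, eval_chiT, eval_add_eq_zero, eval_eqT,
    eval_prehomT ρ (Env.cons y ρ) (c := c) (e := e) hφ (by simp) (by simp) (by simp) v0]
  simp

theorem eval_infOneT {φ : Tm Γ (Ty.one ⇒ Ty.nat)} (hφ : IsE2 (φ.eval ρ)) (c : Tm Γ Ty.col)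
    (e : Tm Γ Ty.one) : (infOneT φ c e).eval ρ = 0 ↔
      ∀ k, ∃ y, k < y ∧ Prehom (c.eval ρ) (e.eval ρ)
        (fun n => (boundT φ.wk c.wk e.wk v0).eval (Env.cons n ρ)) y ∧
        M.app (e.eval ρ) y = S 0 := by
  rw [infOneT, eval_allT ρ hφ]
  refine forall_congr' fun k => ?_
  rw [eval_exT _ (by simpa using hφ)]
  refine exists_congr fun y => ?_
  rw [eval_add_eq_zero, eval_add_eq_zero, eval_eqT, eval_ltT,
    eval_prehomT ρ (Env.cons y (Env.cons k ρ)) (c := c) (e := e) hφ (by simp) (by simp) (by simp)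
      v0]
  simp

/-- On the prehomogeneous set the colour of a pair is the value of e at its smaller element, so
fixing that value gives homogeneity. Value 1 is taken if it occurs infinitely often, and 0
otherwise. -/
theorem homT_spec {φ : Tm Γ (Ty.one ⇒ Ty.nat)} (hφ : IsE2 (φ.eval ρ)) {c : Tm Γ Ty.col}
    {e : Tm Γ Ty.one} (hset : IsSet (e.eval ρ))
    (he : ∀ n, ∃ y, n ≤ y ∧
      ∀ x, x < n → M.app (M.app (c.eval ρ) x) y = M.app (e.eval ρ) x) :
    IsSet ((homT φ c e).eval ρ) ∧ IsInf ((homT φ c e).eval ρ) ∧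
      (HomOf (c.eval ρ) ((homT φ c e).eval ρ) 0 ∨
        HomOf (c.eval ρ) ((homT φ c e).eval ρ) (S 0)) := by
  have hb := isBound_boundT ρ hφ c e
  have hmem := mem_homT ρ hφ c e
  have hone := eval_infOneT ρ hφ c e
  set m := fun n => (boundT φ.wk c.wk e.wk v0).eval (Env.cons n ρ)
  have hhom : HomOf (c.eval ρ) ((homT φ c e).eval ρ)
      ((condT (infOneT φ c e) one zero).eval ρ) := by
    intro x y hxy hx hy
    rw [hmem] at hx hy
    rw [hb.apply_eq hxy hx.1 hy.1, hx.2]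
  refine ⟨fun n => ?_, ?_, ?_⟩
  · rw [homT, Tm.eval_lam]; exact eval_chiT_le _ _
  · by_cases h : (infOneT φ c e).eval ρ = 0
    · have hi : (condT (infOneT φ c e) one zero).eval ρ = S 0 := by simp [h]
      rw [hone] at h
      intro k
      obtain ⟨y, hy, hp, h₁⟩ := h k
      exact ⟨y, hy, (hmem y).2 ⟨hp, h₁.trans hi.symm⟩⟩
    · have hi : (condT (infOneT φ c e) one zero).eval ρ = 0 := by simp [h]
      rw [hone] at h
      push Not at h
      obtain ⟨l, hl⟩ := h
      intro k
      -- Beyond l no member has value 1, so every member there has value 0.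
      obtain ⟨y, hy, hp⟩ := hb.infinite he (max k l)
      refine ⟨y, (le_max_left _ _).trans_lt hy, (hmem y).2 ⟨hp, hi.symm ▸ ?_⟩⟩
      exact ((le_one_iff _).1 (hset y)).resolve_right (hl y ((le_max_right _ _).trans_lt hy) hp)
  · by_cases h : (infOneT φ c e).eval ρ = 0
    · right; simpa [h] using hhom
    · left; simpa [h] using hhom

theorem isURT_urtOfE2 {φ : Tm Γ (Ty.one ⇒ Ty.nat)} (hφ : IsE2 (φ.eval ρ)) :
    IsURT ((urtOfE2 φ).eval ρ) := by
  intro c hc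
  have hφ' : IsE2 (φ.wk.eval (Env.cons c ρ)) := by simpa using hφ
  have hp := isPath_leftPathT _ hφ' (isTree_columnTreeT _ hφ' v0) (isInf_columnTreeT _ hφ' v0)
  rw [urtOfE2, Tm.eval_lam]
  exact homT_spec _ hφ' hp.1 fun n => exists_column_agree _ hφ' (c := v0) hc hp n

end

end HORM

/-- Over `RCA₀^ω`, uniform Ramsey's theorem for pairs, uniform weak König's lemma and `(∃²)` are
equivalent, and the equivalence of the first two is given by closed terms. -/
theorem mainTheorem5 :
    HORM.Provable (HORM.URT.iff HORM.UWKL) ∧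
    HORM.Provable (HORM.URT.iff HORM.E2) ∧
    HORM.Provable (HORM.UWKL.iff HORM.E2) ∧
    (∃ t : HORM.Tm [] ((HORM.Ty.col ⇒ HORM.Ty.one) ⇒ (HORM.Ty.col ⇒ HORM.Ty.nat ⇒ HORM.Ty.nat) ⇒
        (HORM.Ty.one ⇒ HORM.Ty.one)),
      HORM.Provable
        (HORM.Fm.all (HORM.Ty.col ⇒ HORM.Ty.one)
          (HORM.Fm.all (HORM.Ty.col ⇒ HORM.Ty.nat ⇒ HORM.Ty.nat)
            (((HORM.URTfor HORM.v1).and (HORM.infinitudeWitness HORM.v1 HORM.v0)).imp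
              (HORM.UWKLfor (t.ofClosed ⬝ HORM.v1 ⬝ HORM.v0)))))) ∧
    (∃ s : HORM.Tm [] ((HORM.Ty.one ⇒ HORM.Ty.one) ⇒ (HORM.Ty.col ⇒ HORM.Ty.one)),
      HORM.Provable
        (HORM.Fm.all (HORM.Ty.one ⇒ HORM.Ty.one)
          ((HORM.UWKLfor HORM.v0).imp (HORM.URTfor (s.ofClosed ⬝ HORM.v0))))) := by
  have h₁ : ∀ (M : HORM.Str) [M.IsModel], (∃ Ψ : M.D (HORM.Ty.col ⇒ HORM.Ty.one), HORM.IsURT Ψ) →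
      ∃ φ : M.D (HORM.Ty.one ⇒ HORM.Ty.nat), HORM.IsE2 φ := by
    rintro M _ ⟨Ψ, hΨ⟩
    obtain ⟨-, hI, -⟩ := hΨ (HORM.zeroCol.eval (HORM.Env.nil M)) (HORM.isCol_zeroCol _)
    obtain ⟨a, -, ha⟩ := hI 0
    obtain ⟨b, hab, hb⟩ := hI a
    -- For the bare equivalence, a and b may be parameters of the model, so no functional Ξ is
    -- needed.
    have e : HORM.zeroCol.eval (HORM.Env.cons b (HORM.Env.cons a (HORM.Env.cons Ψ
        (HORM.Env.nil M)))) = HORM.zeroCol.eval (HORM.Env.nil M) :=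
      HORM.Str.ext fun x => HORM.Str.ext fun y => by simp [HORM.zeroCol]
    exact ⟨_, HORM.isE2_e2OfURT
      (HORM.Env.cons b (HORM.Env.cons a (HORM.Env.cons Ψ (HORM.Env.nil M))))
      (Ψ := HORM.v2) (a := HORM.v1) (b := HORM.v0) hΨ hab
      (by rw [e]; exact ha) (by rw [e]; exact hb)⟩
  have h₂ : ∀ (M : HORM.Str) [M.IsModel], (∃ Φ : M.D (HORM.Ty.one ⇒ HORM.Ty.one), HORM.IsUWKL Φ) →
      ∃ φ : M.D (HORM.Ty.one ⇒ HORM.Ty.nat), HORM.IsE2 φ := fun M _ ⟨Φ, hΦ⟩ =>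
    ⟨_, HORM.isE2_e2OfUWKL (HORM.Env.cons Φ (HORM.Env.nil M)) (Φ := HORM.v0) hΦ⟩
  have h₃ : ∀ (M : HORM.Str) [M.IsModel], (∃ φ : M.D (HORM.Ty.one ⇒ HORM.Ty.nat), HORM.IsE2 φ) →
      ∃ Φ : M.D (HORM.Ty.one ⇒ HORM.Ty.one), HORM.IsUWKL Φ := fun M _ ⟨φ, hφ⟩ =>
    ⟨_, HORM.isUWKL_uwklOfE2 (HORM.Env.cons φ (HORM.Env.nil M)) (φ := HORM.v0) hφ⟩
  have h₄ : ∀ (M : HORM.Str) [M.IsModel], (∃ φ : M.D (HORM.Ty.one ⇒ HORM.Ty.nat), HORM.IsE2 φ) →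
      ∃ Ψ : M.D (HORM.Ty.col ⇒ HORM.Ty.one), HORM.IsURT Ψ := fun M _ ⟨φ, hφ⟩ =>
    ⟨_, HORM.isURT_urtOfE2 (HORM.Env.cons φ (HORM.Env.nil M)) (φ := HORM.v0) hφ⟩
  -- In the closed term the two elements are read off from Ξ at the constant colouring: a =
  -- Ξ(0-colouring, 0) and b = Ξ(0-colouring, a).
  refine ⟨HORM.provable_of_models fun M _ => ?_, HORM.provable_of_models fun M _ => ?_,
    HORM.provable_of_models fun M _ => ?_, ⟨HORM.lam (HORM.lam (HORM.uwklOfE2 (HORM.e2OfURT HORM.v1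
      (HORM.v0 ⬝ HORM.zeroCol ⬝ HORM.zero)
      (HORM.v0 ⬝ HORM.zeroCol ⬝ (HORM.v0 ⬝ HORM.zeroCol ⬝ HORM.zero))))),
      HORM.provable_of_models fun M _ => ?_⟩,
    ⟨HORM.lam (HORM.urtOfE2 (HORM.e2OfUWKL HORM.v0)), HORM.provable_of_models fun M _ => ?_⟩⟩
  · rw [HORM.sat_iff, HORM.sat_URT, HORM.sat_UWKL]
    exact ⟨fun h => h₃ M (h₁ M h), fun h => h₄ M (h₂ M h)⟩
  · rw [HORM.sat_iff, HORM.sat_URT, HORM.sat_E2]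
    exact ⟨h₁ M, h₄ M⟩
  · rw [HORM.sat_iff, HORM.sat_UWKL, HORM.sat_E2]
    exact ⟨h₂ M, h₃ M⟩
  · intro Ψ Ξ
    rw [HORM.sat_imp, HORM.sat_and, HORM.sat_URTfor, HORM.sat_infinitudeWitness,
      HORM.sat_UWKLfor]
    rintro ⟨hΨ, hΞ⟩
    rw [HORM.Tm.eval_app, HORM.Tm.eval_app, HORM.Tm.eval_ofClosed, HORM.Tm.eval_var,
      HORM.Tm.eval_var, HORM.Tm.eval_lam, HORM.Tm.eval_lam]
    have hw := hΞ _ (HORM.isCol_zeroCol (HORM.Env.cons Ξ (HORM.Env.cons Ψ (HORM.Env.nil M))))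
    exact HORM.isUWKL_uwklOfE2 _ (HORM.isE2_e2OfURT _ hΨ (hw _).1 (hw _).2 (hw _).2)
  · intro Φ
    rw [HORM.sat_imp, HORM.sat_UWKLfor, HORM.sat_URTfor]
    intro hΦ
    rw [HORM.Tm.eval_app, HORM.Tm.eval_ofClosed, HORM.Tm.eval_var, HORM.Tm.eval_lam]
    exact HORM.isURT_urtOfE2 _ (HORM.isE2_e2OfUWKL _ hΦ)
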